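/- Let $n_1\ge n_2\ge\dots$ be a partition of $n$ with Young diagram $\mu$, and index the standard basis of $\mathbb C^n$ by the boxes $(l,k)$ of $\mu$ (row $l$, column $k$, $1\le k\le n_l$). Let $g=sl_n(\mathbb C)$, $t_+=\sum_l\sum_{1\le k<n_l}E_{(l,k),(l,k+1)}\in g$, and let $\delta\in g$ be the diagonal matrix with entry $\bar k-k$ at the box $(l,k)$, where $\bar k$ is the average column number of the boxes. Write $g=g_-\oplus g_0\oplus g_+$ for the decomposition into the parts of negative, zero and positive eigenvalue of $\mathrm{ad}_\delta$ (the eigenvalues are integers). Let $(t_a)$ be a basis of $g$ consisting of eigenvectors of $\mathrm{ad}_\delta$; the index $\alpha$ (and $\beta,\gamma$) runs over the $a$ with $t_a\in g_+$, and $\bar\alpha$ (and $\bar\gamma$) over those with $t_a\in g_-\oplus g_0$. Indices are raised and lowered with the metric $g_{ab}=r\,\mathrm{Tr}(t_at_b)$, where $r\in\mathbb C\setminus\{0\}$ is a fixed normalization ($r=2n$ gives the Killing form); repeated indices are summed. With $[t_a,t_b]=f_{ab}{}^c t_c$ and $t^a=g^{ab}t_b$ we have $[t^a,t^b]=f^{ab}{}_c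 t^c$. Let $J^a$ be the element of $\mathcal U g$ given by $t^a$, let $c_\alpha,b^\alpha$ be the generators of the Clifford algebra $Cl(g_+\oplus g_+^*)$ given by $t_\alpha$ and the dual basis, so that $b^\alpha c_\beta+c_\beta b^\alpha=\delta^\alpha_\beta$ while the $c$'s anticommute among themselves and so do the $b$'s, and let $\chi(J^\alpha)$ be the coefficient of $t_\alpha$ in $t_+$. Put $\Omega=\mathcal U g\otimes Cl(g_+\oplus g_+^*)$, graded by $\deg J^a=0$, $\deg c_\alpha=1$, $\deg b^\alpha=-1$. With the graded commutator $[A,B]=AB-(-1)^{\deg A\deg B}BA$ define $d(X)=[Q,X]$, where $$Q=(J^\alpha-\chi(J^\alpha))c_\alpha-\tfrac12 f^{\alpha\beta}{}_\gamma\, b^\gamma c_\alpha c_\beta ,\qquad\text{and put}\qquad \hat J^a=J^a+f^{a\beta}{}_\gamma\, b^\gamma c_\beta .$$ Theorem. $\Omega=\bigoplus_{k\in\mathbb Z}\Omega^k$ with $d(\Omega^k)\subseteq\Omega^{k+1}$ and $d^2=0$. The algebra $\Omega$ is generated by the $\hat J^a$, $c_\alpha$ and $b^\alpha$, and $$d(\hat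 J^a)=f^{\alpha a}{}_{\bar\gamma}\hat J^{\bar\gamma}c_\alpha-f^{a\beta}{}_\gamma\,\chi(J^\gamma)c_\beta,\qquad d(c_\alpha)=-\tfrac12 f^{\beta\gamma}{}_\alpha c_\beta c_\gamma,\qquad d(b^\alpha)=\hat J^\alpha-\chi(J^\alpha).$$ The subalgebra $\Omega_{red}$ of $\Omega$ generated by the $\hat J^{\bar\alpha}$ and the $c_\alpha$ satisfies $d(\Omega_{red})\subseteq\Omega_{red}$. With $\Omega_{red}^k=\Omega_{red}\cap\Omega^k$, the inclusion $\Omega_{red}\subseteq\Omega$ induces a linear isomorphism $H^k(\Omega_{red};d)\to H^k(\Omega;d)$ for every $k\in\mathbb Z$, and an isomorphism of algebras $$H^*(\Omega_{red};d)\;\cong\;H^*(\Omega;d).$$ -/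

import Mathlib

open scoped TensorProduct

namespace FiniteW

/-! ### Cohomology of subalgebras of a differential superalgebra -/

section Cohomology

variable {R : Type*} [Ring R] [Algebra ℂ R]

/-- An odd derivation `d` of the superalgebra `R` whose parity automorphism is `parity`
(`parity x = (-1) ^ deg x • x` on homogeneous elements). The identity `d ∘ d = 0` is not needed for
the constructions below and is not assumed. -/
structure OddDerivation (R : Type*) [Ring R] [Algebra ℂ R] where
  parity : R →ₐ[ℂ] R
  d : R →ₗ[ℂ] R
  parity_parity : ∀ x, parity (parity x) = x
  leibniz : ∀ x y, d (x * y) = d x * y + parity x * d y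
  d_parity : ∀ x, d (parity x) = -parity (d x)

/-- The odd inner derivation `X ↦ [Q, X] = Q X - (-1) ^ deg X • X Q` of an odd element `Q`. -/
def OddDerivation.inner (σ : R →ₐ[ℂ] R) (hσ : ∀ x, σ (σ x) = x) (Q : R) (hQ : σ Q = -Q) :
    OddDerivation R where
  parity := σ
  d := LinearMap.mulLeft ℂ Q - (LinearMap.mulRight ℂ Q).comp σ.toLinearMap
  parity_parity := hσ
  leibniz x y := by simp; noncomm_ring
  d_parity x := by simp [hσ, hQ, sub_eq_add_neg, add_comm]

namespace OddDerivation

variable (D : OddDerivation R)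

/-- The algebra of cocycles `A ∩ ker d` of a subalgebra `A`. -/
def cocycles (A : Subalgebra ℂ R) : Subalgebra ℂ R where
  carrier := {x | x ∈ A ∧ D.d x = 0}
  mul_mem' := by
    rintro x y ⟨hx, hx'⟩ ⟨hy, hy'⟩
    exact ⟨A.mul_mem hx hy, by rw [D.leibniz, hx', hy']; simp⟩
  add_mem' := by
    rintro x y ⟨hx, hx'⟩ ⟨hy, hy'⟩
    exact ⟨A.add_mem hx hy, by rw [map_add, hx', hy', add_zero]⟩
  algebraMap_mem' r := by
    refine ⟨A.algebraMap_mem r, ?_⟩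
    have h1 : D.d 1 = 0 := by simpa using D.leibniz 1 1
    rw [Algebra.algebraMap_eq_smul_one, map_smul, h1, smul_zero]

/-- The coboundaries `A ∩ ker d ∩ d(A)`, as an ideal of the algebra of cocycles of `A`. -/
def coboundaries (A : Subalgebra ℂ R) (hA : ∀ x ∈ A, D.parity x ∈ A) : Ideal (D.cocycles A) where
  carrier := {z | ∃ w ∈ A, D.d w = z}
  zero_mem' := ⟨0, A.zero_mem, by simp⟩
  add_mem' := by
    rintro x y ⟨v, hv, hv'⟩ ⟨w, hw, hw'⟩
    exact ⟨v + w, A.add_mem hv hw, by simp [hv', hw']⟩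
  smul_mem' := by
    rintro x y ⟨w, hw, hw'⟩
    refine ⟨D.parity x * w, A.mul_mem (hA x x.2.1) hw, ?_⟩
    have hx : D.d (x : R) = 0 := x.2.2
    rw [D.leibniz, D.d_parity, hx, D.parity_parity, hw']
    simp

instance (A : Subalgebra ℂ R) (hA : ∀ x ∈ A, D.parity x ∈ A) :
    (D.coboundaries A hA).IsTwoSided where
  mul_mem_of_left := by
    rintro x y ⟨w, hw, hw'⟩
    refine ⟨w * y, A.mul_mem hw y.2.1, ?_⟩
    have hy : D.d (y : R) = 0 := y.2.2
    rw [D.leibniz, hy, hw']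
    simp

/-- The cohomology algebra `H(A; d) = ker d / im d` of a parity-stable subalgebra `A`. -/
abbrev Cohomology (A : Subalgebra ℂ R) (hA : ∀ x ∈ A, D.parity x ∈ A) : Type _ :=
  D.cocycles A ⧸ D.coboundaries A hA

/-- The homomorphism of cohomology algebras `[z] ↦ [z]` induced by an inclusion `A ≤ B`. -/
def cohomologyMap {A B : Subalgebra ℂ R} (hA : ∀ x ∈ A, D.parity x ∈ A)
    (hB : ∀ x ∈ B, D.parity x ∈ B) (h : A ≤ B) : D.Cohomology A hA →ₐ[ℂ] D.Cohomology B hB :=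
  Ideal.quotientMapₐ (D.coboundaries B hB)
    (Subalgebra.inclusion (S := D.cocycles A) (T := D.cocycles B) fun _ hx => ⟨h hx.1, hx.2⟩)
    (by rintro x ⟨w, hw, hw'⟩; exact ⟨w, h hw, hw'⟩)

variable (𝒢 : ℤ → Submodule ℂ R)

/-- The cocycles of degree `k` of `A`, where `𝒢` is the grading and `A ^ k = A ∩ 𝒢 k`. -/
def degCocycles (A : Subalgebra ℂ R) (k : ℤ) : Submodule ℂ R :=
  Subalgebra.toSubmodule A ⊓ 𝒢 k ⊓ LinearMap.ker D.d

/-- The coboundaries `d(A ^ (k - 1))`. -/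
def degCoboundaries (A : Subalgebra ℂ R) (k : ℤ) : Submodule ℂ R :=
  (Subalgebra.toSubmodule A ⊓ 𝒢 (k - 1)).map D.d

/-- `H ^ k(A; d)`: cocycles of degree `k` modulo the image under `d` of the elements of degree
`k - 1`. -/
abbrev DegCohomology (A : Subalgebra ℂ R) (k : ℤ) : Type _ :=
  D.degCocycles 𝒢 A k ⧸ (D.degCoboundaries 𝒢 A k).submoduleOf (D.degCocycles 𝒢 A k)

/-- The linear map `[z] ↦ [z]` from `H ^ k(A; d)` to `H ^ k(B; d)` induced by `A ≤ B`. -/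
def degCohomologyMap {A B : Subalgebra ℂ R} (h : A ≤ B) (k : ℤ) :
    D.DegCohomology 𝒢 A k →ₗ[ℂ] D.DegCohomology 𝒢 B k :=
  Submodule.mapQ _ _
    (Submodule.inclusion (p := D.degCocycles 𝒢 A k) (p' := D.degCocycles 𝒢 B k)
      fun _ hx => ⟨⟨h hx.1.1, hx.1.2⟩, hx.2⟩)
    (by rintro x ⟨w, hw, hw'⟩; exact ⟨w, ⟨h hw.1, hw.2⟩, hw'⟩)

end OddDerivation

end Cohomology

/-! ### The BRST complex of a graded Lie algebra -/

section BRST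

variable {L : Type*} [LieRing L] [LieAlgebra ℂ L]

/-- `g₊`: the sum of the eigenspaces of `ad δ` with positive integral eigenvalue. -/
def gPlus (δ : L) : Submodule ℂ L :=
  ⨆ k : {k : ℤ // 0 < k}, Module.End.eigenspace (LieAlgebra.ad ℂ L δ : Module.End ℂ L) ((k : ℤ) : ℂ)

/-- The Clifford algebra `Cl(g₊ ⊕ g₊*)` of the quadratic form `(φ, v) ↦ φ v`. -/
abbrev GhostAlgebra (δ : L) : Type _ :=
  CliffordAlgebra (QuadraticForm.dualProd ℂ (gPlus δ))

/-- `Ω = U(g) ⊗ Cl(g₊ ⊕ g₊*)`. -/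
abbrev Omega (δ : L) : Type _ :=
  UniversalEnvelopingAlgebra ℂ L ⊗[ℂ] GhostAlgebra δ

noncomputable section

/-- A generator of `Cl(g₊ ⊕ g₊*)`: a ghost (`v ∈ g₊`) or an antighost (`φ ∈ g₊*`). -/
def ghostLetter (δ : L) : gPlus δ ⊕ Module.Dual ℂ (gPlus δ) → GhostAlgebra δ :=
  Sum.elim (fun v => CliffordAlgebra.ι _ (0, v)) (fun φ => CliffordAlgebra.ι _ (φ, 0))

/-- Ghosts have degree `1`, antighosts have degree `-1`. -/
def ghostDegree (δ : L) : gPlus δ ⊕ Module.Dual ℂ (gPlus δ) → ℤ :=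
  Sum.elim (fun _ => 1) (fun _ => -1)

/-- The component `Ω ^ k`, spanned by the products of an element of `U(g)` (which has degree `0`)
and a word of total degree `k` in ghosts and antighosts. -/
def omegaDegree (δ : L) (k : ℤ) : Submodule ℂ (Omega δ) :=
  Submodule.span ℂ {w | ∃ (u : UniversalEnvelopingAlgebra ℂ L)
    (l : List (gPlus δ ⊕ Module.Dual ℂ (gPlus δ))),
      (l.map (ghostDegree δ)).sum = k ∧ w = u ⊗ₜ[ℂ] (l.map (ghostLetter δ)).prod}

/-- The parity automorphism of `Ω`, fixing `U(g)` and changing the sign of (anti)ghosts. -/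
def omegaParity (δ : L) : Omega δ →ₐ[ℂ] Omega δ :=
  Algebra.TensorProduct.map (AlgHom.id ℂ _) CliffordAlgebra.involute

theorem omegaParity_tmul (δ : L) (u : UniversalEnvelopingAlgebra ℂ L) (x : GhostAlgebra δ) :
    omegaParity δ (u ⊗ₜ x) = u ⊗ₜ CliffordAlgebra.involute x := rfl

theorem omegaParity_omegaParity (δ : L) (x : Omega δ) : omegaParity δ (omegaParity δ x) = x := by
  induction x using TensorProduct.induction_on with
  | zero => simp
  | tmul u x => simp [omegaParity_tmul]
  | add x y hx hy => simp [hx, hy]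

/-- The parity automorphism acts on `Ω ^ k` as `(-1) ^ k`. -/
theorem omegaParity_of_mem (δ : L) {k : ℤ} {x : Omega δ} (hx : x ∈ omegaDegree δ k) :
    omegaParity δ x = (-1 : ℂ) ^ k • x := by
  induction hx using Submodule.span_induction with
  | zero => simp
  | add x y _ _ hx hy => simp [hx, hy]
  | smul a x _ hx => rw [map_smul, hx, smul_comm]
  | mem x hx =>
    obtain ⟨u, l, rfl, rfl⟩ := hx
    rw [omegaParity_tmul, ← TensorProduct.tmul_smul]
    congr 1
    induction l with
    | nil => simp
    | cons a l ih =>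
      have h : CliffordAlgebra.involute (ghostLetter δ a) =
          (-1 : ℂ) ^ ghostDegree δ a • ghostLetter δ a := by
        cases a <;> simp [ghostLetter, ghostDegree]
      simp only [List.map_cons, List.prod_cons, List.sum_cons, map_mul, ih, h]
      rw [zpow_add₀ (by norm_num), smul_mul_smul_comm]

/-- A basis `t_a` of `g` consisting of eigenvectors of `ad δ` with integral eigenvalues. -/
structure HomogeneousBasis (δ : L) (I : Type*) where
  basis : Module.Basis I ℂ L
  deg : I → ℤ
  lie_basis : ∀ a, ⁅δ, basis a⁆ = (deg a : ℂ) • basis a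

namespace HomogeneousBasis

variable {δ : L} {I : Type*} (t : HomogeneousBasis δ I)

/-- The indices `α` of basis elements of `g₊`. -/
abbrev Pos : Type _ := {a : I // 0 < t.deg a}

/-- The barred indices, of basis elements of `g₋ ⊕ g₀`. -/
abbrev NonPos : Type _ := {a : I // t.deg a ≤ 0}

theorem basis_mem_gPlus (α : t.Pos) : t.basis α ∈ gPlus δ :=
  Submodule.mem_iSup_of_mem (⟨t.deg α, α.2⟩ : {k : ℤ // 0 < k})
    (by rw [Module.End.mem_eigenspace_iff]; exact t.lie_basis α)

/-- The ghost `c_α`, given by the basis vector `t_α` of `g₊`. -/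
def ghost (α : t.Pos) : Omega δ :=
  1 ⊗ₜ CliffordAlgebra.ι _ (0, ⟨t.basis α, t.basis_mem_gPlus α⟩)

/-- The antighost `b^α`, given by the coordinate function of `t_α` on `g₊`. -/
def antighost (α : t.Pos) : Omega δ :=
  1 ⊗ₜ CliffordAlgebra.ι _ ((t.basis.coord α).comp (gPlus δ).subtype, 0)

theorem omegaParity_ghost (α : t.Pos) : omegaParity δ (t.ghost α) = -t.ghost α := by
  simp [ghost, omegaParity_tmul, TensorProduct.tmul_neg]

theorem omegaParity_antighost (α : t.Pos) : omegaParity δ (t.antighost α) = -t.antighost α := by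
  simp [antighost, omegaParity_tmul, TensorProduct.tmul_neg]

variable [Fintype I] [DecidableEq I] (κ : LinearMap.BilinForm ℂ L)

/-- The metric `g_ab = (t_a, t_b)`. -/
def metric : Matrix I I ℂ := Matrix.of fun a b => κ (t.basis a) (t.basis b)

/-- `t^a = g^{ab} t_b`, where `g^{ab}` is the inverse matrix of `g_ab`. -/
def upper (a : I) : L := ∑ b, (t.metric κ)⁻¹ a b • t.basis b

/-- The structure constants `f^{ab}_c = g^{aa'} g^{bb'} f_{a'b'}^{c'} g_{c'c}`, where
`[t_a, t_b] = f_{ab}^c t_c`. -/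
def str (a b c : I) : ℂ :=
  ∑ a', ∑ b', ∑ c', (t.metric κ)⁻¹ a a' * (t.metric κ)⁻¹ b b' *
    t.basis.repr ⁅t.basis a', t.basis b'⁆ c' * t.metric κ c' c

/-- The current `J^a`: the element of `U(g)` given by `t^a`, so that `[J^a, J^b] = f^{ab}_c J^c`. -/
def current (a : I) : Omega δ := UniversalEnvelopingAlgebra.ι ℂ (t.upper κ a) ⊗ₜ 1

/-- `Ĵ^a = J^a + f^{aβ}_γ b^γ c_β`. -/
def hatCurrent (a : I) : Omega δ :=
  t.current κ a + ∑ β : t.Pos, ∑ γ : t.Pos, t.str κ a β γ • (t.antighost γ * t.ghost β)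

/-- The value `χ(J^α)`: the coordinate of `e` along `t_α`, the constraints being `J^α = χ(J^α)`,
that is, `π₊(J) = e`. -/
def chi (e : L) (α : t.Pos) : ℂ := t.basis.repr e α

/-- The BRST charge `Q = (J^α - χ(J^α)) c_α - 1/2 f^{αβ}_γ b^γ c_α c_β`. -/
def charge (e : L) : Omega δ :=
  ∑ α : t.Pos, (t.current κ α - algebraMap ℂ _ (t.chi e α)) * t.ghost α -
    (1 / 2 : ℂ) • ∑ α : t.Pos, ∑ β : t.Pos, ∑ γ : t.Pos,
      t.str κ α β γ • (t.antighost γ * t.ghost α * t.ghost β)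

theorem omegaParity_current (a : I) : omegaParity δ (t.current κ a) = t.current κ a := by
  simp [current, omegaParity_tmul]

theorem omegaParity_hatCurrent (a : I) :
    omegaParity δ (t.hatCurrent κ a) = t.hatCurrent κ a := by
  simp [hatCurrent, omegaParity_current, omegaParity_ghost, omegaParity_antighost]

theorem omegaParity_charge (e : L) : omegaParity δ (t.charge κ e) = -t.charge κ e := by
  simp only [charge, map_sub, map_sum, map_mul, map_smul, AlgHom.commutes, omegaParity_current,
    omegaParity_ghost, omegaParity_antighost, mul_neg, neg_mul, neg_neg, smul_neg,
    Finset.sum_neg_distrib]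
  abel

/-- The BRST differential `d(X) = [Q, X]` on `Ω`, with the graded commutator, as an odd
derivation. -/
def brst (e : L) : OddDerivation (Omega δ) :=
  OddDerivation.inner (omegaParity δ) (omegaParity_omegaParity δ) (t.charge κ e)
    (t.omegaParity_charge κ e)

/-- The BRST differential as a linear map. -/
abbrev d (e : L) : Omega δ →ₗ[ℂ] Omega δ := (t.brst κ e).d

/-- On `Ω ^ k` the BRST differential is the graded commutator with `Q`. -/
theorem brst_d_of_mem (e : L) {k : ℤ} {x : Omega δ} (hx : x ∈ omegaDegree δ k) :
    t.d κ e x = t.charge κ e * x - (-1 : ℂ) ^ k • (x * t.charge κ e) := by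
  simp [d, brst, OddDerivation.inner, omegaParity_of_mem δ hx]

/-- `Ω_red`: the subalgebra generated by the `Ĵ^a` with `t_a ∈ g₋ ⊕ g₀` and the ghosts `c_α`. -/
def reduced : Subalgebra ℂ (Omega δ) :=
  Algebra.adjoin ℂ
    (Set.range (fun a : t.NonPos => t.hatCurrent κ a) ∪ Set.range t.ghost)

theorem omegaParity_mem_reduced (x : Omega δ) (hx : x ∈ t.reduced κ) :
    omegaParity δ x ∈ t.reduced κ := by
  induction hx using Algebra.adjoin_induction with
  | mem x hx =>
    rcases hx with ⟨a, rfl⟩ | ⟨α, rfl⟩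
    · simp only [omegaParity_hatCurrent]
      exact Algebra.subset_adjoin (Or.inl ⟨a, rfl⟩)
    · rw [omegaParity_ghost]
      exact neg_mem (Algebra.subset_adjoin (Or.inr ⟨α, rfl⟩))
  | algebraMap r => rw [AlgHom.commutes]; exact Subalgebra.algebraMap_mem _ r
  | add x y _ _ hx hy => rw [map_add]; exact add_mem hx hy
  | mul x y _ _ hx hy => rw [map_mul]; exact mul_mem hx hy

theorem parity_mem_reduced (e : L) : ∀ x ∈ t.reduced κ, (t.brst κ e).parity x ∈ t.reduced κ :=
  t.omegaParity_mem_reduced κ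

theorem parity_mem_top (e : L) :
    ∀ x ∈ (⊤ : Subalgebra ℂ (Omega δ)), (t.brst κ e).parity x ∈ (⊤ : Subalgebra ℂ (Omega δ)) :=
  fun _ _ => Algebra.mem_top

/-- The linear map `H ^ k(Ω_red; d) → H ^ k(Ω; d)` induced by the inclusion `Ω_red ⊆ Ω`. -/
abbrev reducedDegCohomologyMap (e : L) (k : ℤ) :
    (t.brst κ e).DegCohomology (omegaDegree δ) (t.reduced κ) k →ₗ[ℂ]
      (t.brst κ e).DegCohomology (omegaDegree δ) ⊤ k :=
  (t.brst κ e).degCohomologyMap (omegaDegree δ) le_top k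

/-- The algebra homomorphism `H(Ω_red; d) → H(Ω; d)` induced by the inclusion `Ω_red ⊆ Ω`. -/
abbrev reducedCohomologyMap (e : L) :
    (t.brst κ e).Cohomology (t.reduced κ) (t.parity_mem_reduced κ e) →ₐ[ℂ]
      (t.brst κ e).Cohomology ⊤ (t.parity_mem_top κ e) :=
  (t.brst κ e).cohomologyMap _ _ le_top

end HomogeneousBasis

end

end BRST

/-! ### `sl_n` with the `sl_2`-embedding of a partition of `n` -/

section SpecialLinear

/-- The boxes `(l, k)` (row `l`, column `k`) of the Young diagram of a partition `n₁ ≥ n₂ ≥ ...` of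
`n`, of which the row lengths are the `n_l` and the column lengths the `m_k`. They index the
standard basis of `ℂⁿ`: with rows and columns counted from `1`, the box `(l, k)` stands for the
number `l + s_{k-1}`, where `s_t = m_1 + ... + m_t`. -/
abbrev Box (μ : YoungDiagram) : Type := {p : ℕ × ℕ // p ∈ μ.cells}

/-- `sl_n`, as traceless matrices indexed by the boxes of the diagram. -/
abbrev SL (μ : YoungDiagram) : Type := LieAlgebra.SpecialLinear.sl (Box μ) ℂ

noncomputable section

/-- `t₊ = ∑_l ∑_{1 ≤ k < n_l} E_{(l, k), (l, k + 1)}`. -/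
def tPlus (μ : YoungDiagram) : SL μ :=
  ⟨Matrix.of fun p q => if p.1.1 = q.1.1 ∧ p.1.2 + 1 = q.1.2 then 1 else 0, by
    change Matrix.trace _ = 0
    simp [Matrix.trace]⟩

/-- The diagonal matrix `δ` whose entry at a box in column `k` is (average column number) `- k`. -/
def delta (μ : YoungDiagram) : SL μ :=
  ⟨Matrix.diagonal fun p => (∑ q : Box μ, (q.1.2 : ℂ)) / Fintype.card (Box μ) - p.1.2, by
    change Matrix.trace _ = 0
    rw [Matrix.trace_diagonal, Finset.sum_sub_distrib, Finset.sum_const, Finset.card_univ,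
      nsmul_eq_mul]
    rcases isEmpty_or_nonempty (Box μ) with h | h
    · simp
    · rw [mul_div_cancel₀ _ (Nat.cast_ne_zero.2 Fintype.card_ne_zero), sub_self]⟩

/-- The trace form `(x, y) = Tr (x y)`; the Cartan–Killing form of `sl_n` is `2 n` times it. -/
def trForm (μ : YoungDiagram) : LinearMap.BilinForm ℂ (SL μ) :=
  LinearMap.mk₂ ℂ (fun x y => Matrix.trace (x.1 * y.1))
    (fun x y z => by simp [add_mul]) (fun c x y => by simp)
    (fun x y z => by simp [mul_add]) (fun c x y => by simp)

end

end SpecialLinear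

end FiniteW

/-! The relation `d b^α = Ĵ^α - χ(J^α)` makes the pairs `(d b^α, b^α)` contractible, and `Ω_red` is
what remains after removing them. Let N be the algebra generated by the letters `d b^α` and `b^α`.
The letters can be moved to the right past `Ω_red`, so Ω = `Ω_red` · N (`mem_reducedFiltration`),
filtered by the number of letters.

On N the homotopy is that of a Koszul complex: it replaces one letter `d b^α` by `b^α`. Concretely
h₀(w) = ∑ σ(D_α w) b^α, where σ is the parity and D_α = (1 ⊗ φ_α)Δ is built from the coproduct of
the enveloping algebra and a functional φ_α with φ_α(1) = 0 and φ_α(t^β) = δ_αβ. D_α removes a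
letter `d b^α`, up to shorter words. Commutators of letters, with the appropriate signs, are linear
in the letters, so modulo shorter words d h₀ + h₀ d multiplies a word by its length
(`d_contraction_add_prod_sub_mem`).

To extend h₀ to Ω by h(r w) = σ(r) h₀(w) for r in `Ω_red`, one needs U(g) to factor along the
splitting of the indices into nonpositive and positive ones (`exists_linear_extension`). This rests
on the linear independence half of Poincaré-Birkhoff-Witt (`linearIndependent_words`), obtained from
the same operators: compositions of the D_a, followed by the counit, separate words of maximal
length. The functionals φ_a come from the trace in the defining representation of sl_n.

Then h vanishes on `Ω_red` (`exists_homotopy`). Since positive lengths are invertible in ℂ,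
induction on the filtration shows that a cochain with coboundary in `Ω_red` is a coboundary plus an
element of `Ω_red` (`exists_sub_d_mem_reduced`). Both bijectivity claims follow.

For d² = 0, the operator d² is the commutator with Q², so it is enough to check generators: there it
follows from the Jacobi identity and, for the antighosts, from the fact that `t₊` has degree one. -/

namespace FiniteW

/-! ### Dual bases for an invariant metric -/

section Metric

variable {L : Type*} [LieRing L] [LieAlgebra ℂ L]

/-- A nondegenerate invariant bilinear form. -/
structure IsInvariantMetric (κ : LinearMap.BilinForm ℂ L) : Prop where
  nondegenerate : κ.Nondegenerate
  invariant : ∀ x y z, κ ⁅x, y⁆ z = κ x ⁅y, z⁆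

namespace HomogeneousBasis

variable {δ : L} {I : Type*} (t : HomogeneousBasis δ I) [Fintype I] [DecidableEq I]
  {κ : LinearMap.BilinForm ℂ L} (hκ : IsInvariantMetric κ)

omit [DecidableEq I] in
theorem repr_lie_delta (x : L) (a : I) :
    t.basis.repr ⁅δ, x⁆ a = (t.deg a : ℂ) * t.basis.repr x a := by
  classical
  rw [congr_arg (fun y => t.basis.repr ⁅δ, y⁆ a) (t.basis.sum_repr x).symm]
  simp [-Module.Basis.sum_repr, lie_sum, t.lie_basis, Finsupp.single_apply, mul_comm]

include hκ

theorem metric_inv_mul : (t.metric κ)⁻¹ * t.metric κ = 1 := by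
  have h := (LinearMap.BilinForm.nondegenerate_iff_det_ne_zero t.basis).1 hκ.nondegenerate
  have h' : LinearMap.BilinForm.toMatrix t.basis κ = t.metric κ := by
    ext a b
    simp [metric, LinearMap.BilinForm.toMatrix_apply]
  rw [h'] at h
  exact Matrix.nonsing_inv_mul _ (isUnit_iff_ne_zero.2 h)

theorem form_upper_basis (a b : I) : κ (t.upper κ a) (t.basis b) = if a = b then 1 else 0 := by
  have h := congr_fun (congr_fun (t.metric_inv_mul hκ) a) b
  simpa [Matrix.mul_apply, metric, upper, Matrix.one_apply] using h

omit [Fintype I] [DecidableEq I] in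
theorem ext_form {x y : L} (h : ∀ a, κ x (t.basis a) = κ y (t.basis a)) : x = y := by
  have h' : κ x = κ y := t.basis.ext h
  exact sub_eq_zero.1 (hκ.nondegenerate.1 _ fun z => by simp [h'])

theorem sum_form_smul_upper (x : L) : ∑ a, κ x (t.basis a) • t.upper κ a = x := by
  refine t.ext_form hκ fun b => ?_
  simp [t.form_upper_basis hκ]

-- This form of the structure constants allows coordinate-free computation: antisymmetry, invariance
-- and the Jacobi identity become those of the bracket.
omit hκ in
theorem str_eq (a b c : I) : t.str κ a b c = κ ⁅t.upper κ a, t.upper κ b⁆ (t.basis c) := by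
  have h : ∀ x, κ x (t.basis c) = ∑ c', t.basis.repr x c' * t.metric κ c' c := fun x => by
    rw [congr_arg κ (t.basis.sum_repr x).symm]
    simp only [map_sum, map_smul, LinearMap.sum_apply, LinearMap.smul_apply, smul_eq_mul, metric,
      Matrix.of_apply]
  have h2 : ⁅t.upper κ a, t.upper κ b⁆ = ∑ a', ∑ b', ((t.metric κ)⁻¹ a a' * (t.metric κ)⁻¹ b b') •
      ⁅t.basis a', t.basis b'⁆ := by
    simp only [upper, sum_lie, lie_sum, smul_lie, lie_smul, Finset.smul_sum, smul_smul]
    rw [Finset.sum_comm]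
    refine Finset.sum_congr rfl fun _ _ => Finset.sum_congr rfl fun _ _ => by rw [mul_comm]
  rw [h2]
  simp only [map_sum, map_smul, LinearMap.sum_apply, LinearMap.smul_apply, h, smul_eq_mul,
    Finset.mul_sum, str, mul_assoc]

theorem lie_upper (a b : I) :
    ⁅t.upper κ a, t.upper κ b⁆ = ∑ c, t.str κ a b c • t.upper κ c := by
  simp only [t.str_eq]
  exact (t.sum_form_smul_upper hκ _).symm

/-- Invariance makes `ad δ` skew for the metric, so raising an index reverses the degree: positive
indices give vectors `t^α` in g₋, nonpositive ones vectors in g₀ ⊕ g₊. -/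
theorem lie_delta_upper (a : I) : ⁅δ, t.upper κ a⁆ = -(t.deg a : ℂ) • t.upper κ a := by
  refine t.ext_form hκ fun b => ?_
  rw [← lie_skew, map_neg, LinearMap.neg_apply, hκ.invariant, t.lie_basis]
  simp only [map_smul, smul_eq_mul, t.form_upper_basis hκ, LinearMap.smul_apply]
  split_ifs with h <;> simp [h]

/-- Pair [δ, [t^a, t^b]] with t_c in two ways: by the derivation rule, and by moving δ onto t_c
through invariance. -/
theorem deg_eq_of_str_ne_zero {a b c : I} (h : t.str κ a b c ≠ 0) :
    t.deg c = t.deg a + t.deg b := by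
  rw [t.str_eq] at h
  have h1 : ⁅δ, ⁅t.upper κ a, t.upper κ b⁆⁆ =
      -((t.deg a : ℂ) + t.deg b) • ⁅t.upper κ a, t.upper κ b⁆ := by
    rw [leibniz_lie, t.lie_delta_upper hκ, t.lie_delta_upper hκ]
    simp only [smul_lie, lie_smul]
    module
  have h2 := congr_arg (fun x => κ x (t.basis c)) h1
  rw [← lie_skew] at h2
  simp only [map_neg, LinearMap.neg_apply, hκ.invariant, t.lie_basis] at h2
  simp only [← hκ.invariant, map_smul, LinearMap.smul_apply, smul_eq_mul, ← neg_mul] at h2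
  have h3 := mul_right_cancel₀ h h2
  exact_mod_cast neg_injective h3

omit hκ in
theorem str_swap (a b c : I) : t.str κ b a c = -t.str κ a b c := by
  rw [t.str_eq, t.str_eq, ← lie_skew, map_neg, LinearMap.neg_apply]

/-- The `a`-th coordinate of an element of degree one vanishes unless `t_a` has degree one. -/
theorem chi_mul_str {e : L} (he : ⁅δ, e⁆ = e) {a b : I} (ha : 0 < t.deg a) (hb : 0 < t.deg b)
    (c : t.Pos) : t.str κ a b c * t.chi e c = 0 := by
  by_contra h
  have h1 := t.deg_eq_of_str_ne_zero hκ (left_ne_zero_of_mul h)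
  have h2 := right_ne_zero_of_mul h
  have h4 := t.repr_lie_delta e c
  rw [he] at h4
  have h5 : (t.deg c : ℂ) = 1 := by
    have h6 : t.chi e c = (t.deg c : ℂ) * t.chi e c := h4
    exact mul_right_cancel₀ h2 (by rw [← h6, one_mul])
  have h7 : t.deg c = 1 := by exact_mod_cast h5
  omega

end HomogeneousBasis

end Metric

/-! ### Generators and grading of `Ω` -/

section Generators

variable {L : Type*} [LieRing L] [LieAlgebra ℂ L]

/-- The universal property gives a map into the generated subalgebra; composed with the inclusion it
fixes the generators, so it is the identity. -/
theorem adjoin_range_ι_eq_top :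
    Algebra.adjoin ℂ (Set.range (UniversalEnvelopingAlgebra.ι ℂ (L := L))) = ⊤ := by
  let _ : LieRing (UniversalEnvelopingAlgebra ℂ L) := LieRing.ofAssociativeRing
  set S := Algebra.adjoin ℂ (Set.range (UniversalEnvelopingAlgebra.ι ℂ (L := L))) with hS
  let _ : LieRing S := LieRing.ofAssociativeRing
  let f : L →ₗ⁅ℂ⁆ S :=
    { toFun := fun x => ⟨UniversalEnvelopingAlgebra.ι ℂ x, Algebra.subset_adjoin ⟨x, rfl⟩⟩
      map_add' := fun x y => Subtype.ext (map_add _ x y)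
      map_smul' := fun r x => Subtype.ext (map_smul _ r x)
      map_lie' := fun {x y} => Subtype.ext (LieHom.map_lie _ x y) }
  have h : S.val.comp (UniversalEnvelopingAlgebra.lift ℂ f) =
      AlgHom.id ℂ (UniversalEnvelopingAlgebra ℂ L) := by
    refine UniversalEnvelopingAlgebra.hom_ext ℂ (LieHom.ext fun x => ?_)
    change ((UniversalEnvelopingAlgebra.lift ℂ f (UniversalEnvelopingAlgebra.ι ℂ x) : S) :
      UniversalEnvelopingAlgebra ℂ L) = UniversalEnvelopingAlgebra.ι ℂ x
    rw [UniversalEnvelopingAlgebra.lift_ι_apply]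
    rfl
  refine eq_top_iff.2 fun x _ => ?_
  rw [← AlgHom.id_apply (R := ℂ) x, ← h]
  exact (UniversalEnvelopingAlgebra.lift ℂ f x).2

theorem ι_lie (x y : L) : UniversalEnvelopingAlgebra.ι ℂ ⁅x, y⁆ =
    UniversalEnvelopingAlgebra.ι ℂ x * UniversalEnvelopingAlgebra.ι ℂ y -
      UniversalEnvelopingAlgebra.ι ℂ y * UniversalEnvelopingAlgebra.ι ℂ x := by
  let _ : LieRing (UniversalEnvelopingAlgebra ℂ L) := LieRing.ofAssociativeRing
  exact LieHom.map_lie _ x y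

theorem one_mem_omegaDegree (δ : L) : (1 : Omega δ) ∈ omegaDegree δ 0 :=
  Submodule.subset_span ⟨1, [], rfl, rfl⟩

theorem mul_mem_omegaDegree {δ : L} {j k l : ℤ} {x y : Omega δ} (hx : x ∈ omegaDegree δ j)
    (hy : y ∈ omegaDegree δ k) (hl : j + k = l) : x * y ∈ omegaDegree δ l := by
  subst hl
  have h := Submodule.mul_mem_mul hx hy
  rw [omegaDegree, omegaDegree, Submodule.span_mul_span] at h
  refine Submodule.span_mono ?_ h
  rintro _ ⟨_, ⟨u, l, rfl, rfl⟩, _, ⟨v, m, rfl, rfl⟩, rfl⟩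
  exact ⟨u * v, l ++ m, by simp, by simp⟩

theorem parity_mem_omegaDegree {δ : L} {k : ℤ} {x : Omega δ} (hx : x ∈ omegaDegree δ k) :
    omegaParity δ x ∈ omegaDegree δ k := by
  rw [omegaParity_of_mem δ hx]
  exact Submodule.smul_mem _ _ hx

theorem tmul_one_mem_omegaDegree (δ : L) (u : UniversalEnvelopingAlgebra ℂ L) :
    (u ⊗ₜ 1 : Omega δ) ∈ omegaDegree δ 0 :=
  Submodule.subset_span ⟨u, [], rfl, rfl⟩

theorem tmul_ghostLetter_mem_omegaDegree (δ : L) (s : gPlus δ ⊕ Module.Dual ℂ (gPlus δ)) :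
    (1 ⊗ₜ ghostLetter δ s : Omega δ) ∈ omegaDegree δ (ghostDegree δ s) :=
  Submodule.subset_span ⟨1, [s], by simp, by simp⟩

/-- The automorphism of the Clifford algebra multiplying ghosts by `2` and antighosts by `1/2`. -/
noncomputable def ghostScaling (δ : L) : GhostAlgebra δ →ₐ[ℂ] GhostAlgebra δ :=
  CliffordAlgebra.map
    { toLinearMap := LinearMap.prodMap ((2⁻¹ : ℂ) • LinearMap.id) ((2 : ℂ) • LinearMap.id)
      map_app' := fun m => by simp }

theorem ghostScaling_ghostLetter (δ : L) (s : gPlus δ ⊕ Module.Dual ℂ (gPlus δ)) :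
    ghostScaling δ (ghostLetter δ s) = (2 : ℂ) ^ ghostDegree δ s • ghostLetter δ s := by
  have h : ∀ φ v, ghostScaling δ (CliffordAlgebra.ι _ (φ, v)) =
      CliffordAlgebra.ι _ ((2⁻¹ : ℂ) • φ, (2 : ℂ) • v) := fun φ v =>
    CliffordAlgebra.map_apply_ι _ _
  cases s <;> simp [h, ghostLetter, ghostDegree, ← map_smul]

/-- Directness of the grading is reduced to the independence of eigenspaces: the powers of 2 are
distinct eigenvalues of the scaling automorphism. -/
theorem omegaDegree_le_eigenspace (δ : L) (k : ℤ) :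
    omegaDegree δ k ≤ Module.End.eigenspace (TensorProduct.map LinearMap.id
      (ghostScaling δ).toLinearMap : Module.End ℂ (Omega δ)) ((2 : ℂ) ^ k) := by
  refine Submodule.span_le.2 ?_
  rintro _ ⟨u, l, rfl, rfl⟩
  rw [SetLike.mem_coe, Module.End.mem_eigenspace_iff, TensorProduct.map_tmul,
    ← TensorProduct.tmul_smul]
  simp only [LinearMap.id_apply, AlgHom.toLinearMap_apply]
  congr 1
  induction l with
  | nil => simp
  | cons a l ih =>
    simp only [List.map_cons, List.prod_cons, List.sum_cons, map_mul, ih,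
      ghostScaling_ghostLetter]
    rw [zpow_add₀ two_ne_zero, smul_mul_smul_comm]

theorem two_zpow_injective : Function.Injective fun k : ℤ => (2 : ℂ) ^ k := fun j k h => by
  have h2 : (2 : ℝ) ^ j = 2 ^ k := by
    have := congr_arg norm h
    simpa using this
  exact zpow_right_injective₀ (by norm_num) (by norm_num) h2

theorem ghostLetter_cover (δ : L) (x : GhostAlgebra δ) :
    x ∈ Submodule.span ℂ (Set.range fun l : List (gPlus δ ⊕ Module.Dual ℂ (gPlus δ)) =>
      (l.map (ghostLetter δ)).prod) := by
  have hι : ∀ m, CliffordAlgebra.ι (QuadraticForm.dualProd ℂ (gPlus δ)) m =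
      ghostLetter δ (.inl m.2) + ghostLetter δ (.inr m.1) := fun m => by
    simp [ghostLetter, ← map_add]
  have hl : ∀ s, ghostLetter δ s ∈ Submodule.span ℂ (Set.range fun l :
      List (gPlus δ ⊕ Module.Dual ℂ (gPlus δ)) => (l.map (ghostLetter δ)).prod) := fun s =>
    Submodule.subset_span ⟨[s], by simp⟩
  induction x using CliffordAlgebra.induction with
  | algebraMap r =>
    rw [Algebra.algebraMap_eq_smul_one]
    exact Submodule.smul_mem _ _ (Submodule.subset_span ⟨[], rfl⟩)
  | ι m => rw [hι]; exact add_mem (hl _) (hl _)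
  | mul a b ha hb =>
    have h := Submodule.mul_mem_mul ha hb
    rw [Submodule.span_mul_span] at h
    refine Submodule.span_mono ?_ h
    rintro _ ⟨_, ⟨l, rfl⟩, _, ⟨m, rfl⟩, rfl⟩
    exact ⟨l ++ m, by simp⟩
  | add a b ha hb => exact add_mem ha hb

theorem iSup_omegaDegree (δ : L) : iSup (omegaDegree δ) = ⊤ := by
  refine eq_top_iff.2 fun x hx => ?_
  clear hx
  induction x using TensorProduct.induction_on with
  | zero => exact zero_mem _
  | add x y hx hy => exact add_mem hx hy
  | tmul u x =>
    induction ghostLetter_cover δ x using Submodule.span_induction with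
    | mem x hx =>
      obtain ⟨l, rfl⟩ := hx
      exact Submodule.mem_iSup_of_mem _ (Submodule.subset_span ⟨u, l, rfl, rfl⟩)
    | zero => simp
    | add x y _ _ hx hy => rw [TensorProduct.tmul_add]; exact add_mem hx hy
    | smul a x _ hx => rw [TensorProduct.tmul_smul]; exact Submodule.smul_mem _ _ hx

theorem isInternal_omegaDegree (δ : L) : DirectSum.IsInternal (omegaDegree δ) := by
  rw [DirectSum.isInternal_submodule_iff_iSupIndep_and_iSup_eq_top]
  exact ⟨((Module.End.eigenspaces_iSupIndep _).comp two_zpow_injective).mono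
    (omegaDegree_le_eigenspace δ), iSup_omegaDegree δ⟩

namespace HomogeneousBasis

variable {δ : L} {I : Type*} (t : HomogeneousBasis δ I)

theorem ghost_mem_omegaDegree (α : t.Pos) : t.ghost α ∈ omegaDegree δ 1 :=
  tmul_ghostLetter_mem_omegaDegree δ (.inl _)

theorem antighost_mem_omegaDegree (α : t.Pos) : t.antighost α ∈ omegaDegree δ (-1) :=
  tmul_ghostLetter_mem_omegaDegree δ (.inr _)

theorem ghost_mul_ghost (α β : t.Pos) : t.ghost α * t.ghost β = -(t.ghost β * t.ghost α) := by
  have h := CliffordAlgebra.ι_mul_ι_add_swap (Q := QuadraticForm.dualProd ℂ (gPlus δ))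
    (0, ⟨t.basis α, t.basis_mem_gPlus α⟩) (0, ⟨t.basis β, t.basis_mem_gPlus β⟩)
  simp only [QuadraticMap.polar, QuadraticForm.dualProd_apply] at h
  simp only [ghost, Algebra.TensorProduct.tmul_mul_tmul, one_mul, ← TensorProduct.tmul_neg]
  congr 1
  exact eq_neg_of_add_eq_zero_left (by simpa using h)

theorem antighost_mul_antighost (α β : t.Pos) :
    t.antighost α * t.antighost β = -(t.antighost β * t.antighost α) := by
  have h := CliffordAlgebra.ι_mul_ι_add_swap (Q := QuadraticForm.dualProd ℂ (gPlus δ))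
    ((t.basis.coord α).comp (gPlus δ).subtype, 0) ((t.basis.coord β).comp (gPlus δ).subtype, 0)
  simp only [QuadraticMap.polar, QuadraticForm.dualProd_apply] at h
  simp only [antighost, Algebra.TensorProduct.tmul_mul_tmul, one_mul, ← TensorProduct.tmul_neg]
  congr 1
  exact eq_neg_of_add_eq_zero_left (by simpa using h)

theorem antighost_mul_ghost [DecidableEq I] (α β : t.Pos) :
    t.antighost α * t.ghost β = (if α = β then 1 else 0) - t.ghost β * t.antighost α := by
  have h := CliffordAlgebra.ι_mul_ι_add_swap (Q := QuadraticForm.dualProd ℂ (gPlus δ))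
    ((t.basis.coord α).comp (gPlus δ).subtype, 0) (0, ⟨t.basis β, t.basis_mem_gPlus β⟩)
  simp only [QuadraticMap.polar, QuadraticForm.dualProd_apply] at h
  rw [eq_sub_iff_add_eq]
  simp only [antighost, ghost, Algebra.TensorProduct.tmul_mul_tmul, one_mul,
    ← TensorProduct.tmul_add, h]
  simp only [Prod.mk_add_mk, add_zero, zero_add, LinearMap.comp_apply, Submodule.subtype_apply,
    Module.Basis.coord_apply, Module.Basis.repr_self, LinearMap.zero_apply, sub_zero, map_zero,
    Finsupp.single_apply, Subtype.ext_iff, eq_comm (a := (β : I))]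
  split_ifs <;> simp [Algebra.TensorProduct.one_def]

variable [Fintype I] [DecidableEq I] {κ : LinearMap.BilinForm ℂ L}

theorem current_mem_omegaDegree (a : I) : t.current κ a ∈ omegaDegree δ 0 :=
  tmul_one_mem_omegaDegree δ _

theorem current_mul_ghost (a : I) (α : t.Pos) :
    t.current κ a * t.ghost α = t.ghost α * t.current κ a := by
  simp [current, ghost]

theorem current_mul_antighost (a : I) (α : t.Pos) :
    t.current κ a * t.antighost α = t.antighost α * t.current κ a := by
  simp [current, antighost]

theorem charge_mem_omegaDegree (e : L) : t.charge κ e ∈ omegaDegree δ 1 := by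
  refine sub_mem (sum_mem fun α _ => ?_) (Submodule.smul_mem _ _ (sum_mem fun α _ =>
    sum_mem fun β _ => sum_mem fun γ _ => Submodule.smul_mem _ _ ?_))
  · refine mul_mem_omegaDegree (sub_mem (t.current_mem_omegaDegree _) ?_)
      (t.ghost_mem_omegaDegree α) (zero_add 1)
    rw [Algebra.algebraMap_eq_smul_one]
    exact Submodule.smul_mem _ _ (one_mem_omegaDegree δ)
  · exact mul_mem_omegaDegree (mul_mem_omegaDegree (t.antighost_mem_omegaDegree γ)
      (t.ghost_mem_omegaDegree α) (neg_add_cancel 1)) (t.ghost_mem_omegaDegree β) (zero_add 1)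

theorem d_mem_omegaDegree (e : L) {k : ℤ} {x : Omega δ} (hx : x ∈ omegaDegree δ k) :
    t.d κ e x ∈ omegaDegree δ (k + 1) := by
  rw [t.brst_d_of_mem κ e hx]
  exact sub_mem (mul_mem_omegaDegree (t.charge_mem_omegaDegree e) hx (add_comm _ _))
    (Submodule.smul_mem _ _ (mul_mem_omegaDegree hx (t.charge_mem_omegaDegree e) rfl))

-- An eigenvector of eigenvalue k > 0 has nonzero coordinates only along basis vectors of degree k.
omit [DecidableEq I] in
theorem gPlus_le_span : gPlus δ ≤ Submodule.span ℂ (Set.range fun α : t.Pos => t.basis α) := by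
  refine iSup_le fun k x hx => ?_
  rw [Module.End.mem_eigenspace_iff, LieAlgebra.ad_apply] at hx
  have h : ∀ a, (t.deg a : ℂ) * t.basis.repr x a = (k : ℤ) * t.basis.repr x a := fun a => by
    rw [← t.repr_lie_delta, hx, map_smul, Finsupp.smul_apply, smul_eq_mul]
  rw [← t.basis.sum_repr x]
  refine sum_mem fun a _ => ?_
  by_cases ha : 0 < t.deg a
  · exact Submodule.smul_mem _ _ (Submodule.subset_span ⟨⟨a, ha⟩, rfl⟩)
  · by_cases h0 : t.basis.repr x a = 0
    · simp [h0]
    · have h2 : t.deg a = k := by exact_mod_cast mul_right_cancel₀ h0 (h a)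
      have := k.2
      omega

/-- The currents, ghosts and antighosts generate `Ω`. -/
theorem adjoin_current_eq_top (hκ : IsInvariantMetric κ) :
    Algebra.adjoin ℂ (Set.range (t.current κ) ∪ Set.range t.ghost ∪ Set.range t.antighost) =
      ⊤ := by
  set S := Algebra.adjoin ℂ (Set.range (t.current κ) ∪ Set.range t.ghost ∪ Set.range t.antighost)
  have hJ : ∀ a, t.current κ a ∈ S := fun a => Algebra.subset_adjoin (Or.inl (Or.inl ⟨a, rfl⟩))
  have hc : ∀ α, t.ghost α ∈ S := fun α => Algebra.subset_adjoin (Or.inl (Or.inr ⟨α, rfl⟩))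
  have hb : ∀ α, t.antighost α ∈ S := fun α => Algebra.subset_adjoin (Or.inr ⟨α, rfl⟩)
  have hU : S.comap Algebra.TensorProduct.includeLeft = ⊤ := by
    refine eq_top_iff.2 ?_
    rw [← adjoin_range_ι_eq_top]
    refine Algebra.adjoin_le ?_
    rintro _ ⟨x, rfl⟩
    change (UniversalEnvelopingAlgebra.ι ℂ x ⊗ₜ 1 : Omega δ) ∈ S
    rw [← t.sum_form_smul_upper hκ x]
    simp only [map_sum, map_smul, TensorProduct.sum_tmul, ← TensorProduct.smul_tmul']
    exact sum_mem fun a _ => Subalgebra.smul_mem _ (hJ a) _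
  have hC : S.comap (Algebra.TensorProduct.includeRight (R := ℂ)
      (A := UniversalEnvelopingAlgebra ℂ L)) = ⊤ := by
    refine eq_top_iff.2 ?_
    rw [← CliffordAlgebra.adjoin_range_ι]
    refine Algebra.adjoin_le ?_
    rintro _ ⟨⟨φ, v⟩, rfl⟩
    change (1 ⊗ₜ CliffordAlgebra.ι _ (φ, v) : Omega δ) ∈ S
    have h1 : ∃ c : t.Pos → ℂ, ∑ α, c α • t.basis α = (v : L) := by
      have := t.gPlus_le_span v.2
      rwa [Submodule.mem_span_range_iff_exists_fun] at this
    obtain ⟨c, h1⟩ := h1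
    have hv : v = ∑ α : t.Pos, c α • ⟨t.basis α, t.basis_mem_gPlus α⟩ := by
      ext; simp [← h1]
    have hφ : φ = ∑ α : t.Pos, φ ⟨t.basis α, t.basis_mem_gPlus α⟩ •
        (t.basis.coord α).comp (gPlus δ).subtype := by
      ext w
      obtain ⟨c, hc⟩ : ∃ c : t.Pos → ℂ, ∑ α, c α • t.basis α = (w : L) := by
        have := t.gPlus_le_span w.2
        rwa [Submodule.mem_span_range_iff_exists_fun] at this
      have hw : w = ∑ α : t.Pos, c α • ⟨t.basis α, t.basis_mem_gPlus α⟩ := by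
        ext; simp [← hc]
      rw [hw]
      simp only [map_sum, map_smul]
      refine Finset.sum_congr rfl fun β _ => congr_arg _ ?_
      simp [Finsupp.single_apply, ← Subtype.ext_iff]
    have h2 : (φ, v) = ∑ α : t.Pos, φ ⟨t.basis α, t.basis_mem_gPlus α⟩ •
        ((t.basis.coord α).comp (gPlus δ).subtype, (0 : gPlus δ)) +
        ∑ α : t.Pos, c α • ((0 : Module.Dual ℂ (gPlus δ)), ⟨t.basis α, t.basis_mem_gPlus α⟩) := by
      refine Prod.ext ?_ ?_
      · simpa [Prod.fst_sum] using hφ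
      · simpa [Prod.snd_sum] using hv
    rw [h2]
    simp only [map_add, map_sum, map_smul, TensorProduct.tmul_add, TensorProduct.tmul_sum,
      TensorProduct.tmul_smul]
    exact add_mem (sum_mem fun α _ => Subalgebra.smul_mem _ (hb α) _)
      (sum_mem fun α _ => Subalgebra.smul_mem _ (hc α) _)
  refine eq_top_iff.2 fun x hx => ?_
  clear hx
  induction x using TensorProduct.induction_on with
  | zero => exact zero_mem _
  | add x y hx hy => exact add_mem hx hy
  | tmul u x =>
    have h1 : u ∈ S.comap Algebra.TensorProduct.includeLeft := hU ▸ Algebra.mem_top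
    have h2 : x ∈ S.comap (Algebra.TensorProduct.includeRight (R := ℂ)
      (A := UniversalEnvelopingAlgebra ℂ L)) := hC ▸ Algebra.mem_top
    simpa using mul_mem (show (u ⊗ₜ 1 : Omega δ) ∈ S from h1) (show (1 ⊗ₜ x : Omega δ) ∈ S from h2)

theorem adjoin_hatCurrent_eq_top (hκ : IsInvariantMetric κ) :
    Algebra.adjoin ℂ (Set.range (t.hatCurrent κ) ∪ Set.range t.ghost ∪ Set.range t.antighost) =
      ⊤ := by
  refine eq_top_iff.2 ?_
  rw [← t.adjoin_current_eq_top hκ]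
  set S := Algebra.adjoin ℂ
    (Set.range (t.hatCurrent κ) ∪ Set.range t.ghost ∪ Set.range t.antighost)
  have hJ : ∀ a, t.hatCurrent κ a ∈ S := fun a => Algebra.subset_adjoin (Or.inl (Or.inl ⟨a, rfl⟩))
  have hc : ∀ α, t.ghost α ∈ S := fun α => Algebra.subset_adjoin (Or.inl (Or.inr ⟨α, rfl⟩))
  have hb : ∀ α, t.antighost α ∈ S := fun α => Algebra.subset_adjoin (Or.inr ⟨α, rfl⟩)
  refine Algebra.adjoin_le ?_
  rintro _ ((⟨a, rfl⟩ | h) | h)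
  · have h : t.current κ a = t.hatCurrent κ a - ∑ β : t.Pos, ∑ γ : t.Pos,
        t.str κ a β γ • (t.antighost γ * t.ghost β) := by simp [hatCurrent]
    rw [h]
    exact sub_mem (hJ a) (sum_mem fun β _ => sum_mem fun γ _ =>
      Subalgebra.smul_mem _ (mul_mem (hb γ) (hc β)) _)
  · exact Algebra.subset_adjoin (Or.inl (Or.inr h))
  · exact Algebra.subset_adjoin (Or.inr h)

end HomogeneousBasis

end Generators

/-! ### The BRST differential on generators -/

section Differential

variable {L : Type*} [LieRing L] [LieAlgebra ℂ L]

/-- The linear map `x ↦ J(x)` from `L` to `Ω`. -/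
noncomputable def currentMap (δ : L) : L →ₗ[ℂ] Omega δ where
  toFun x := UniversalEnvelopingAlgebra.ι ℂ x ⊗ₜ 1
  map_add' x y := by rw [map_add, TensorProduct.add_tmul]
  map_smul' r x := by rw [map_smul, TensorProduct.smul_tmul', RingHom.id_apply]

theorem currentMap_apply (δ x : L) :
    currentMap δ x = UniversalEnvelopingAlgebra.ι ℂ x ⊗ₜ 1 := rfl

theorem currentMap_lie (δ x y : L) :
    currentMap δ ⁅x, y⁆ = currentMap δ x * currentMap δ y - currentMap δ y * currentMap δ x := by
  simp only [currentMap_apply, ι_lie, TensorProduct.sub_tmul, Algebra.TensorProduct.tmul_mul_tmul,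
    mul_one]

/-- The antighost of the linear form `κ x` on `g₊`. -/
noncomputable def antighostMap (δ : L) (κ : LinearMap.BilinForm ℂ L) : L →ₗ[ℂ] Omega δ :=
  (Algebra.TensorProduct.includeRight (R := ℂ) (A := UniversalEnvelopingAlgebra ℂ L)
    (B := GhostAlgebra δ)).toLinearMap ∘ₗ CliffordAlgebra.ι _ ∘ₗ LinearMap.inl ℂ _ _ ∘ₗ
      LinearMap.lcomp ℂ ℂ (gPlus δ).subtype ∘ₗ κ

theorem antighostMap_apply (δ : L) (κ : LinearMap.BilinForm ℂ L) (x : L) :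
    antighostMap δ κ x = 1 ⊗ₜ CliffordAlgebra.ι _ ((κ x).comp (gPlus δ).subtype, 0) := rfl

theorem OddDerivation.d_algebraMap {R : Type*} [Ring R] [Algebra ℂ R] (D : OddDerivation R)
    (r : ℂ) : D.d (algebraMap ℂ R r) = 0 := by
  have h1 : D.d 1 = 0 := by simpa using D.leibniz 1 1
  rw [Algebra.algebraMap_eq_smul_one, map_smul, h1, smul_zero]

namespace HomogeneousBasis

variable {δ : L} {I : Type*} (t : HomogeneousBasis δ I) [Fintype I]

theorem sum_pos_add_sum_nonPos {M : Type*} [AddCommMonoid M] (F : I → M) :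
    ∑ α : t.Pos, F α + ∑ α : t.NonPos, F α = ∑ a, F a := by
  rw [← Fintype.sum_subtype_add_sum_subtype (fun a => 0 < t.deg a) F]
  congr 1
  exact Fintype.sum_equiv (Equiv.subtypeEquivRight fun a => not_lt.symm) _ _ fun _ => rfl

/-- Symmetric coefficients meet antisymmetric products, so the sum equals its own negative. -/
theorem sum_mul_ghost_mul_ghost_eq_zero (g : t.Pos → t.Pos → Omega δ)
    (h : ∀ α β, g α β = g β α) : ∑ α, ∑ β, g α β * (t.ghost α * t.ghost β) = 0 := by
  have h1 : ∑ α, ∑ β, g α β * (t.ghost α * t.ghost β) =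
      -∑ α, ∑ β, g α β * (t.ghost α * t.ghost β) := by
    conv_lhs => rw [Finset.sum_comm]
    simp only [← Finset.sum_neg_distrib]
    refine Finset.sum_congr rfl fun α _ => Finset.sum_congr rfl fun β _ => ?_
    rw [h, t.ghost_mul_ghost, mul_neg]
  have h2 : (2 : ℂ) • ∑ α, ∑ β, g α β * (t.ghost α * t.ghost β) = 0 := by
    rw [two_smul]
    nth_rewrite 1 [h1]
    exact neg_add_cancel _
  exact (smul_eq_zero.1 h2).resolve_left two_ne_zero

omit [Fintype I] in
theorem ghost_mul_ghost_mul_ghost (α β γ : t.Pos) :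
    t.ghost α * t.ghost β * t.ghost γ = t.ghost β * t.ghost γ * t.ghost α := by
  rw [t.ghost_mul_ghost α β, neg_mul, mul_assoc, t.ghost_mul_ghost α γ, mul_neg, neg_neg,
    mul_assoc]

/-- A triple product of ghosts is invariant under cyclic rotation, so only the cyclic average of the
coefficients matters. It is applied with the Jacobi identity as `h`. -/
theorem sum_smul_ghost_eq_zero (g : t.Pos → t.Pos → t.Pos → ℂ)
    (h : ∀ α β γ, g α β γ + g β γ α + g γ α β = 0) :
    ∑ α, ∑ β, ∑ γ, g α β γ • (t.ghost α * t.ghost β * t.ghost γ) = 0 := by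
  have h1 : ∀ g : t.Pos → t.Pos → t.Pos → ℂ,
      ∑ α, ∑ β, ∑ γ, g α β γ • (t.ghost α * t.ghost β * t.ghost γ) =
      ∑ α, ∑ β, ∑ γ, g γ α β • (t.ghost α * t.ghost β * t.ghost γ) := fun g => by
    rw [Finset.sum_comm]
    refine Finset.sum_congr rfl fun α _ => ?_
    rw [Finset.sum_comm]
    refine Finset.sum_congr rfl fun β _ => Finset.sum_congr rfl fun γ _ => ?_
    rw [t.ghost_mul_ghost_mul_ghost γ α β]
  have h2 : (3 : ℂ) • ∑ α, ∑ β, ∑ γ, g α β γ • (t.ghost α * t.ghost β * t.ghost γ) = 0 := by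
    rw [show (3 : ℂ) = 1 + 1 + 1 by norm_num, add_smul, add_smul, one_smul]
    nth_rewrite 3 [(h1 g).trans (h1 _)]
    nth_rewrite 2 [h1 g]
    simp only [← Finset.sum_add_distrib, ← add_smul]
    refine Finset.sum_eq_zero fun α _ => Finset.sum_eq_zero fun β _ =>
      Finset.sum_eq_zero fun γ _ => ?_
    rw [show g α β γ + g γ α β + g β γ α = g α β γ + g β γ α + g γ α β by ring, h, zero_smul]
  exact (smul_eq_zero.1 h2).resolve_left three_ne_zero

variable [DecidableEq I] {κ : LinearMap.BilinForm ℂ L} (hκ : IsInvariantMetric κ)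

theorem current_eq (a : I) : t.current κ a = currentMap δ (t.upper κ a) := rfl

theorem antighostMap_eq_sum (x : L) :
    antighostMap δ κ x = ∑ γ : t.Pos, κ x (t.basis γ) • t.antighost γ := by
  have h : (κ x).comp (gPlus δ).subtype =
      ∑ γ : t.Pos, κ x (t.basis γ) • (t.basis.coord γ).comp (gPlus δ).subtype := by
    ext w
    obtain ⟨c, hc⟩ : ∃ c : t.Pos → ℂ, ∑ α, c α • t.basis α = (w : L) := by
      have := t.gPlus_le_span w.2
      rwa [Submodule.mem_span_range_iff_exists_fun] at this
    simp [← hc, Finsupp.single_apply, ← Subtype.ext_iff, mul_comm]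
  rw [antighostMap_apply, h]
  simp only [antighost, ← TensorProduct.tmul_smul, ← TensorProduct.tmul_sum, ← map_smul,
    ← map_sum, Prod.smul_mk, smul_zero]
  congr 2
  refine Prod.ext ?_ ?_ <;> simp [Prod.fst_sum, Prod.snd_sum]

theorem antighostMap_mul_ghost (x : L) (α : t.Pos) :
    antighostMap δ κ x * t.ghost α =
      algebraMap ℂ _ (κ x (t.basis α)) - t.ghost α * antighostMap δ κ x := by
  simp only [t.antighostMap_eq_sum, Finset.sum_mul, Finset.mul_sum, smul_mul_assoc, mul_smul_comm,
    t.antighost_mul_ghost, smul_sub, Finset.sum_sub_distrib, Algebra.algebraMap_eq_smul_one]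
  simp

theorem antighostMap_mul_antighost (x : L) (α : t.Pos) :
    antighostMap δ κ x * t.antighost α = -(t.antighost α * antighostMap δ κ x) := by
  simp only [t.antighostMap_eq_sum, Finset.sum_mul, Finset.mul_sum, smul_mul_assoc, mul_smul_comm,
    t.antighost_mul_antighost _ α, smul_neg, Finset.sum_neg_distrib]

theorem omegaParity_antighostMap (x : L) :
    omegaParity δ (antighostMap δ κ x) = -antighostMap δ κ x := by
  simp [antighostMap_apply, omegaParity_tmul, TensorProduct.tmul_neg]

theorem sum_str_smul_antighost (a b : I) :
    ∑ γ : t.Pos, t.str κ a b γ • t.antighost γ =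
      antighostMap δ κ ⁅t.upper κ a, t.upper κ b⁆ := by
  simp only [t.antighostMap_eq_sum, t.str_eq]

/-- The linear map `x ↦ Ĵ(x)`. -/
noncomputable def hatMap (κ : LinearMap.BilinForm ℂ L) : L →ₗ[ℂ] Omega δ where
  toFun x := currentMap δ x + ∑ β : t.Pos, antighostMap δ κ ⁅x, t.upper κ β⁆ * t.ghost β
  map_add' x y := by
    simp only [map_add, add_lie, add_mul, Finset.sum_add_distrib]
    abel
  map_smul' r x := by
    simp only [map_smul, smul_lie, smul_mul_assoc, ← Finset.smul_sum, RingHom.id_apply, smul_add]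

theorem hatMap_apply (x : L) : t.hatMap κ x =
    currentMap δ x + ∑ β : t.Pos, antighostMap δ κ ⁅x, t.upper κ β⁆ * t.ghost β := rfl

theorem hatCurrent_eq (a : I) : t.hatCurrent κ a = t.hatMap κ (t.upper κ a) := by
  simp only [hatCurrent, hatMap_apply, current_eq, ← t.sum_str_smul_antighost, Finset.sum_mul,
    smul_mul_assoc]

theorem charge_eq (e : L) : t.charge κ e =
    ∑ α : t.Pos, (t.current κ α - algebraMap ℂ _ (t.chi e α)) * t.ghost α -
      (1 / 2 : ℂ) • ∑ α : t.Pos, ∑ β : t.Pos,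
        antighostMap δ κ ⁅t.upper κ α, t.upper κ β⁆ * t.ghost α * t.ghost β := by
  simp only [charge, ← t.sum_str_smul_antighost, Finset.sum_mul, smul_mul_assoc]

theorem d_apply (e : L) (x : Omega δ) :
    t.d κ e x = t.charge κ e * x - omegaParity δ x * t.charge κ e := by
  simp [d, brst, OddDerivation.inner]

theorem d_mul (e : L) (x y : Omega δ) :
    t.d κ e (x * y) = t.d κ e x * y + omegaParity δ x * t.d κ e y :=
  (t.brst κ e).leibniz x y

theorem currentMap_mul_antighostMap (x y : L) :
    currentMap δ x * antighostMap δ κ y = antighostMap δ κ y * currentMap δ x := by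
  simp [currentMap_apply, antighostMap_apply]

omit [Fintype I] [DecidableEq I] in
theorem currentMap_mul_ghost (x : L) (α : t.Pos) :
    currentMap δ x * t.ghost α = t.ghost α * currentMap δ x := by
  simp [currentMap_apply, ghost]

/-- The scalars χ and the purely ghost part of the charge commute with J(x); only J^α c_α
contributes. -/
theorem d_currentMap (e x : L) :
    t.d κ e (currentMap δ x) =
      ∑ α : t.Pos, currentMap δ ⁅t.upper κ α, x⁆ * t.ghost α := by
  have hp : omegaParity δ (currentMap δ x) = currentMap δ x := by
    simp [currentMap_apply, omegaParity_tmul]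
  rw [d_apply, hp, charge_eq, sub_mul, mul_sub, smul_mul_assoc, mul_smul_comm]
  have h : ∀ α β : t.Pos, antighostMap δ κ ⁅t.upper κ α, t.upper κ β⁆ * t.ghost α * t.ghost β *
      currentMap δ x = currentMap δ x *
        (antighostMap δ κ ⁅t.upper κ α, t.upper κ β⁆ * t.ghost α * t.ghost β) := fun α β => by
    rw [mul_assoc, ← currentMap_mul_ghost, ← mul_assoc, mul_assoc (antighostMap δ κ _),
      ← currentMap_mul_ghost, ← mul_assoc, ← currentMap_mul_antighostMap]
    simp only [mul_assoc]
  simp only [Finset.sum_mul, Finset.mul_sum, h, sub_sub_sub_cancel_right]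
  rw [← Finset.sum_sub_distrib]
  refine Finset.sum_congr rfl fun α _ => ?_
  rw [mul_assoc, ← currentMap_mul_ghost, currentMap_lie, ← current_eq, ← mul_assoc, ← mul_assoc,
    ← sub_mul, sub_mul _ _ (currentMap δ x), mul_sub, Algebra.commutes]
  congr 1
  abel

theorem d_ghost (e : L) (α : t.Pos) : t.d κ e (t.ghost α) =
      -((1 / 2 : ℂ) • ∑ β : t.Pos, ∑ γ : t.Pos, t.str κ β γ α • (t.ghost β * t.ghost γ)) := by
  rw [d_apply, omegaParity_ghost, neg_mul, sub_neg_eq_add, charge_eq, sub_mul, mul_sub,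
    smul_mul_assoc, mul_smul_comm, sub_add_sub_comm, ← smul_add]
  have h1 : (∑ β : t.Pos, (t.current κ β - algebraMap ℂ _ (t.chi e β)) * t.ghost β) * t.ghost α +
      t.ghost α * ∑ β : t.Pos, (t.current κ β - algebraMap ℂ _ (t.chi e β)) * t.ghost β = 0 := by
    rw [Finset.sum_mul, Finset.mul_sum, ← Finset.sum_add_distrib]
    refine Finset.sum_eq_zero fun β _ => ?_
    rw [mul_assoc, t.ghost_mul_ghost, ← mul_assoc (t.ghost α), mul_sub, ← t.current_mul_ghost,
      ← Algebra.commutes, ← sub_mul, mul_assoc, mul_neg, neg_add_cancel]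
  rw [h1, zero_sub]
  congr 2
  simp only [Finset.sum_mul, Finset.mul_sum, ← Finset.sum_add_distrib]
  refine Finset.sum_congr rfl fun β _ => Finset.sum_congr rfl fun γ _ => ?_
  -- A ghost passes the even product of two ghosts without sign, so only its anticommutator with the
  -- antighost survives.
  have h2 : ∀ b : Omega δ, b * t.ghost β * t.ghost γ * t.ghost α =
      b * t.ghost α * t.ghost β * t.ghost γ := fun b => by
    rw [mul_assoc b, mul_assoc b, mul_assoc b, mul_assoc b, ← t.ghost_mul_ghost_mul_ghost]
  rw [h2, t.antighostMap_mul_ghost, t.str_eq, sub_mul, sub_mul, Algebra.smul_def]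
  simp only [mul_assoc, sub_add_cancel]

theorem d_antighost (e : L) (α : t.Pos) : t.d κ e (t.antighost α) =
    t.hatCurrent κ α - algebraMap ℂ _ (t.chi e α) := by
  rw [d_apply, omegaParity_antighost, neg_mul, sub_neg_eq_add, charge_eq, sub_mul, mul_sub,
    smul_mul_assoc, mul_smul_comm, sub_add_sub_comm, ← smul_add]
  have h1 : (∑ β : t.Pos, (t.current κ β - algebraMap ℂ _ (t.chi e β)) * t.ghost β) *
      t.antighost α + t.antighost α * ∑ β : t.Pos,
        (t.current κ β - algebraMap ℂ _ (t.chi e β)) * t.ghost β =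
      t.current κ α - algebraMap ℂ _ (t.chi e α) := by
    rw [Finset.sum_mul, Finset.mul_sum, ← Finset.sum_add_distrib, Finset.sum_eq_single α]
    · rw [← mul_assoc, mul_sub, ← t.current_mul_antighost, ← Algebra.commutes, ← sub_mul,
        mul_assoc, mul_assoc, ← mul_add, t.antighost_mul_ghost, if_pos rfl, add_sub_cancel, mul_one]
    · intro β _ hβ
      rw [← mul_assoc, mul_sub, ← t.current_mul_antighost, ← Algebra.commutes, ← sub_mul,
        mul_assoc, mul_assoc, ← mul_add, t.antighost_mul_ghost, if_neg (Ne.symm hβ), zero_sub,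
        add_neg_cancel, mul_zero]
    · simp
  -- The antighost can be contracted with either of the two ghosts, with opposite signs.
  have h2 : ∀ β γ (x : L), antighostMap δ κ x * t.ghost β * t.ghost γ * t.antighost α +
      t.antighost α * (antighostMap δ κ x * t.ghost β * t.ghost γ) =
      (if α = γ then antighostMap δ κ x * t.ghost β else 0) -
        (if α = β then antighostMap δ κ x * t.ghost γ else 0) := fun β γ x => by
    have h3 : t.ghost γ * t.antighost α = (if α = γ then 1 else 0) - t.antighost α * t.ghost γ := by
      rw [t.antighost_mul_ghost, sub_sub_cancel]
    have h4 : t.ghost β * t.antighost α = (if α = β then 1 else 0) - t.antighost α * t.ghost β := by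
      rw [t.antighost_mul_ghost, sub_sub_cancel]
    have h5 := t.antighostMap_mul_antighost (κ := κ) x α
    rw [mul_assoc _ (t.ghost γ), h3, mul_sub, ← mul_assoc _ (t.antighost α),
      mul_assoc _ (t.ghost β) (t.antighost α), h4, mul_sub, ← mul_assoc _ (t.antighost α), h5]
    split_ifs <;> noncomm_ring
  rw [h1]
  simp only [Finset.sum_mul, Finset.mul_sum, ← Finset.sum_add_distrib, h2]
  simp only [Finset.sum_sub_distrib, Finset.sum_ite_eq, Finset.mem_univ, if_true]
  rw [Finset.sum_comm (f := fun x y => if α = x then _ else _)]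
  simp only [Finset.sum_ite_eq, Finset.mem_univ, if_true]
  rw [hatCurrent_eq, hatMap_apply, current_eq]
  -- By antisymmetry of the bracket the two contractions agree, which cancels the factor 1/2 of the
  -- charge and leaves the ghost part of Ĵ^α.
  have h6 : ∀ β : t.Pos, antighostMap δ κ ⁅t.upper κ β, t.upper κ α⁆ =
      -antighostMap δ κ ⁅t.upper κ α, t.upper κ β⁆ := fun β => by rw [← map_neg, lie_skew]
  simp only [h6, neg_mul, Finset.sum_neg_distrib]
  module

theorem d_antighostMap (e x : L) : t.d κ e (antighostMap δ κ x) =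
    ∑ γ : t.Pos, κ x (t.basis γ) • (t.hatCurrent κ γ - algebraMap ℂ _ (t.chi e γ)) := by
  rw [t.antighostMap_eq_sum]
  simp only [map_sum, map_smul, t.d_antighost]

theorem hatMap_eq_sum (hκ : IsInvariantMetric κ) (x : L) : t.hatMap κ x =
    ∑ γ : t.Pos, κ x (t.basis γ) • t.hatCurrent κ γ +
      ∑ γ : t.NonPos, κ x (t.basis γ) • t.hatCurrent κ γ := by
  rw [t.sum_pos_add_sum_nonPos fun γ => κ x (t.basis γ) • t.hatCurrent κ γ]
  conv_lhs => rw [← t.sum_form_smul_upper hκ x]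
  simp only [map_sum, map_smul, hatCurrent_eq]

theorem lie_upper_pos (hκ : IsInvariantMetric κ) (α β : t.Pos) :
    ⁅t.upper κ α, t.upper κ β⁆ = ∑ γ : t.Pos, t.str κ α β γ • t.upper κ γ := by
  rw [t.lie_upper hκ, ← t.sum_pos_add_sum_nonPos, add_eq_left]
  refine Finset.sum_eq_zero fun γ _ => ?_
  by_cases h : t.str κ α β γ = 0
  · rw [h, zero_smul]
  · have h1 := t.deg_eq_of_str_ne_zero hκ h
    have := γ.2
    have := α.2
    have := β.2
    omega

/-- A sum of `d c_β` with linear coefficients, in terms of the Lie bracket. -/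
theorem sum_mul_d_ghost (hκ : IsInvariantMetric κ) (e : L) (F : L →ₗ[ℂ] Omega δ) :
    ∑ β : t.Pos, F (t.upper κ β) * t.d κ e (t.ghost β) = ∑ α : t.Pos, ∑ β : t.Pos,
      (-(1 / 2 : ℂ) • F ⁅t.upper κ α, t.upper κ β⁆) * (t.ghost α * t.ghost β) := by
  simp only [t.d_ghost, mul_smul_comm, ← Finset.smul_sum, ← neg_smul, Finset.mul_sum,
    smul_mul_assoc]
  congr 1
  rw [Finset.sum_comm]
  refine Finset.sum_congr rfl fun α _ => ?_
  rw [Finset.sum_comm]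
  refine Finset.sum_congr rfl fun β _ => ?_
  rw [t.lie_upper_pos hκ]
  simp only [map_sum, map_smul, Finset.sum_mul, smul_mul_assoc]

/-- The ghost part of Ĵ is there to complete J([t^α, x]) c_α to Ĵ([t^α, x]) c_α. Differentiating its
antighosts subtracts the components of Ĵ([t^α, x]) along positive indices and produces the χ term,
so only barred indices remain. -/
theorem d_hatCurrent (hκ : IsInvariantMetric κ) (e : L) (a : I) :
    t.d κ e (t.hatCurrent κ a) =
      ∑ α : t.Pos, ∑ γ : t.NonPos, t.str κ α a γ • (t.hatCurrent κ γ * t.ghost α) -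
        ∑ β : t.Pos, ∑ γ : t.Pos, (t.str κ a β γ * t.chi e γ) • t.ghost β := by
  set x := t.upper κ a with hx
  have h1 : ∀ α : t.Pos, ∑ γ : t.NonPos, t.str κ α a γ • (t.hatCurrent κ γ * t.ghost α) =
      currentMap δ ⁅t.upper κ α, x⁆ * t.ghost α + ∑ β : t.Pos,
        antighostMap δ κ ⁅⁅t.upper κ α, x⁆, t.upper κ β⁆ * (t.ghost β * t.ghost α) -
      (∑ γ : t.Pos, t.str κ α a γ • t.hatCurrent κ γ) * t.ghost α := fun α => by
    have h := t.hatMap_eq_sum hκ ⁅t.upper κ α, x⁆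
    rw [hatMap_apply, ← sub_eq_iff_eq_add'] at h
    simp only [← smul_mul_assoc, ← Finset.sum_mul, t.str_eq, ← mul_assoc]
    rw [← h, sub_mul, add_mul]
  have h2 : t.d κ e (t.hatCurrent κ a) = ∑ α : t.Pos, currentMap δ ⁅t.upper κ α, x⁆ * t.ghost α +
      (∑ α : t.Pos, t.d κ e (antighostMap δ κ ⁅x, t.upper κ α⁆) * t.ghost α -
        ∑ α : t.Pos, antighostMap δ κ ⁅x, t.upper κ α⁆ * t.d κ e (t.ghost α)) := by
    simp only [hatCurrent_eq, hatMap_apply, map_add, map_sum, d_currentMap, d_mul,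
      omegaParity_antighostMap, neg_mul, Finset.sum_add_distrib, Finset.sum_neg_distrib, hx,
      sub_eq_add_neg]
  have h3 : ∀ α : t.Pos, t.d κ e (antighostMap δ κ ⁅x, t.upper κ α⁆) * t.ghost α =
      -((∑ γ : t.Pos, t.str κ α a γ • t.hatCurrent κ γ) * t.ghost α) -
        ∑ γ : t.Pos, (t.str κ a α γ * t.chi e γ) • t.ghost α := fun α => by
    rw [d_antighostMap]
    simp only [smul_sub, Finset.sum_sub_distrib, sub_mul, t.str_swap a α, t.str_eq, neg_smul,
      Finset.sum_neg_distrib, neg_mul, neg_neg, mul_smul, Finset.sum_mul, smul_mul_assoc,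
      Algebra.algebraMap_eq_smul_one, one_mul, hx]
  have h4 := t.sum_mul_d_ghost hκ e
    (antighostMap δ κ ∘ₗ (LieAlgebra.ad ℂ L x : Module.End ℂ L))
  simp only [LinearMap.comp_apply, LieAlgebra.ad_apply] at h4
  -- The terms with one antighost and two ghosts cancel: by the Jacobi identity their combined
  -- coefficient is symmetric in α and β.
  have h5 : ∑ α : t.Pos, ∑ β : t.Pos, antighostMap δ κ ⁅⁅t.upper κ α, x⁆, t.upper κ β⁆ *
      (t.ghost β * t.ghost α) + ∑ α : t.Pos, ∑ β : t.Pos, (-(1 / 2 : ℂ) •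
        antighostMap δ κ ⁅x, ⁅t.upper κ α, t.upper κ β⁆⁆) * (t.ghost α * t.ghost β) = 0 := by
    rw [Finset.sum_comm]
    simp only [← Finset.sum_add_distrib, ← add_mul]
    refine t.sum_mul_ghost_mul_ghost_eq_zero _ fun α β => ?_
    simp only [← map_smul, ← map_add]
    congr 1
    rw [← lie_skew (t.upper κ β) (t.upper κ α), lie_neg, leibniz_lie x, ← lie_skew x,
      ← lie_skew x, neg_lie, lie_neg, ← lie_skew (t.upper κ α) ⁅_, x⁆]
    module
  rw [h2, h4]
  simp only [h1, h3, Finset.sum_sub_distrib, Finset.sum_add_distrib, Finset.sum_neg_distrib]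
  rw [eq_neg_of_add_eq_zero_left h5]
  abel

/-- Since `d c` is quadratic in ghosts, it commutes with ghosts. Each of the two Leibniz terms is
then a cubic ghost sum whose cyclically summed coefficient vanishes by Jacobi. -/
theorem d_d_ghost (hκ : IsInvariantMetric κ) (e : L) (α : t.Pos) :
    t.d κ e (t.d κ e (t.ghost α)) = 0 := by
  have h1 : ∀ β γ, t.ghost β * t.d κ e (t.ghost γ) = t.d κ e (t.ghost γ) * t.ghost β :=
    fun β γ => by
      rw [d_ghost]
      simp only [mul_neg, neg_mul, mul_smul_comm, smul_mul_assoc, Finset.mul_sum, Finset.sum_mul]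
      congr 2
      refine Finset.sum_congr rfl fun μ _ => Finset.sum_congr rfl fun ν _ => ?_
      rw [← mul_assoc, t.ghost_mul_ghost_mul_ghost]
  have h2 : ∑ β : t.Pos, ∑ γ : t.Pos, t.str κ β γ α • (t.d κ e (t.ghost β) * t.ghost γ) = 0 := by
    have h3 : ∀ γ : t.Pos, ∑ β : t.Pos, t.str κ β γ α • t.d κ e (t.ghost β) =
        ∑ μ : t.Pos, ∑ ν : t.Pos, (-(1 / 2 : ℂ) *
          κ ⁅⁅t.upper κ μ, t.upper κ ν⁆, t.upper κ γ⁆ (t.basis α)) •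
            (t.ghost μ * t.ghost ν) := fun γ => by
      obtain ⟨F, hF⟩ : ∃ F : L →ₗ[ℂ] Omega δ,
          ∀ y, F y = algebraMap ℂ _ (κ ⁅y, t.upper κ γ⁆ (t.basis α)) :=
        ⟨Algebra.linearMap ℂ (Omega δ) ∘ₗ κ.flip (t.basis α) ∘ₗ
          (-(LieAlgebra.ad ℂ L (t.upper κ γ) : Module.End ℂ L)), fun y => by
          simp only [LinearMap.comp_apply, LinearMap.neg_apply, LieAlgebra.ad_apply, lie_skew,
            Algebra.linearMap_apply, LinearMap.BilinForm.flip_apply]⟩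
      have h := t.sum_mul_d_ghost hκ e F
      simp only [hF, ← Algebra.smul_def, ← t.str_eq] at h
      rw [h]
      simp only [smul_mul_assoc, ← Algebra.smul_def, mul_smul]
    rw [Finset.sum_comm]
    simp only [← smul_mul_assoc, ← Finset.sum_mul, h3]
    simp only [Finset.sum_mul, smul_mul_assoc]
    rw [Finset.sum_comm]
    have h4 := t.sum_smul_ghost_eq_zero (fun μ ν γ => -(1 / 2 : ℂ) *
          κ ⁅⁅t.upper κ μ, t.upper κ ν⁆, t.upper κ γ⁆ (t.basis α)) fun μ ν γ => by
      rw [← mul_add, ← mul_add, ← LinearMap.add_apply, ← LinearMap.add_apply, ← map_add, ← map_add]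
      have := lie_jacobi (t.upper κ μ) (t.upper κ ν) (t.upper κ γ)
      rw [← lie_skew _ ⁅t.upper κ ν, _⁆, ← lie_skew _ ⁅t.upper κ γ, _⁆,
        ← lie_skew _ ⁅t.upper κ μ, _⁆, ← neg_add, ← neg_add, neg_eq_zero] at this
      rw [show ∀ x y z : L, x + y + z = y + z + x from fun x y z => by abel, this]
      simp
    rw [← h4]
    refine Finset.sum_congr rfl fun μ _ => ?_
    rw [Finset.sum_comm]
  have h5 : ∑ β : t.Pos, ∑ γ : t.Pos, t.str κ β γ α • (t.d κ e (t.ghost γ) * t.ghost β) = 0 := by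
    rw [Finset.sum_comm, ← neg_eq_zero, ← h2]
    simp only [← Finset.sum_neg_distrib, ← neg_smul, ← t.str_swap]
  rw [d_ghost]
  simp only [map_neg, map_smul, map_sum, d_mul, omegaParity_ghost, neg_mul, h1, smul_add, smul_neg,
    Finset.sum_add_distrib, Finset.sum_neg_distrib, h2, h5]
  simp

theorem d_d_currentMap (hκ : IsInvariantMetric κ) (e x : L) :
    t.d κ e (t.d κ e (currentMap δ x)) = 0 := by
  have hp : ∀ y, omegaParity δ (currentMap δ y) = currentMap δ y := fun y => by
    simp [currentMap_apply, omegaParity_tmul]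
  have h := t.sum_mul_d_ghost hκ e
    (-(currentMap δ ∘ₗ (LieAlgebra.ad ℂ L x : Module.End ℂ L)))
  simp only [LinearMap.comp_apply, LieAlgebra.ad_apply, LinearMap.neg_apply, ← map_neg,
    lie_skew] at h
  rw [d_currentMap]
  simp only [map_sum, d_mul, hp, d_currentMap, Finset.sum_add_distrib, h, Finset.sum_mul]
  rw [Finset.sum_comm]
  simp only [mul_assoc, ← Finset.sum_add_distrib, ← add_mul]
  refine t.sum_mul_ghost_mul_ghost_eq_zero _ fun α β => ?_
  simp only [← map_smul, ← map_add]
  congr 1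
  rw [← lie_skew (t.upper κ β) (t.upper κ α), neg_lie, lie_lie (t.upper κ α)]
  module

/-- Both terms of `d Ĵ^α` vanish for degree reasons: two positive degrees add up neither to a
nonpositive degree nor to 1, the only degree in which χ lives. -/
theorem d_d_antighost (hκ : IsInvariantMetric κ) {e : L} (he : ⁅δ, e⁆ = e) (α : t.Pos) :
    t.d κ e (t.d κ e (t.antighost α)) = 0 := by
  rw [d_antighost, map_sub, t.d_hatCurrent hκ, (t.brst κ e).d_algebraMap, sub_zero, sub_eq_zero]
  rw [Finset.sum_eq_zero, Finset.sum_eq_zero]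
  · exact fun β _ => Finset.sum_eq_zero fun γ _ => by
      rw [t.chi_mul_str hκ he α.2 β.2, zero_smul]
  · intro β _
    refine Finset.sum_eq_zero fun γ _ => ?_
    by_cases h : t.str κ β α γ = 0
    · rw [h, zero_smul]
    · have h1 := t.deg_eq_of_str_ne_zero hκ h
      have := γ.2
      have := α.2
      have := β.2
      omega

theorem d_d_eq (e : L) (x : Omega δ) :
    t.d κ e (t.d κ e x) = t.charge κ e * t.charge κ e * x - x * (t.charge κ e * t.charge κ e) := by
  simp only [d_apply, map_sub, map_mul, omegaParity_charge, omegaParity_omegaParity]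
  noncomm_ring

/-- The elements killed by d² form the centralizer of Q², a subalgebra; hence generators suffice,
and Q² itself need not be computed. -/
theorem d_d (hκ : IsInvariantMetric κ) {e : L} (he : ⁅δ, e⁆ = e) (x : Omega δ) :
    t.d κ e (t.d κ e x) = 0 := by
  have h : Algebra.adjoin ℂ (Set.range (t.current κ) ∪ Set.range t.ghost ∪
      Set.range t.antighost) ≤ Subalgebra.centralizer ℂ {t.charge κ e * t.charge κ e} := by
    refine Algebra.adjoin_le ?_
    rintro y hy
    have hy' : t.d κ e (t.d κ e y) = 0 := by
      rcases hy with (⟨a, rfl⟩ | ⟨α, rfl⟩) | ⟨α, rfl⟩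
      · exact t.d_d_currentMap hκ e _
      · exact t.d_d_ghost hκ e α
      · exact t.d_d_antighost hκ he α
    rw [SetLike.mem_coe, Subalgebra.mem_centralizer_iff]
    rintro _ rfl
    rwa [d_d_eq, sub_eq_zero] at hy'
  rw [t.adjoin_current_eq_top hκ] at h
  rw [d_d_eq, sub_eq_zero]
  exact (Subalgebra.mem_centralizer_iff ℂ).1 (h Algebra.mem_top) _ rfl

theorem d_mem_reduced (hκ : IsInvariantMetric κ) (e : L) (x : Omega δ) (hx : x ∈ t.reduced κ) :
    t.d κ e x ∈ t.reduced κ := by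
  have hJ : ∀ a : t.NonPos, t.hatCurrent κ a ∈ t.reduced κ := fun a =>
    Algebra.subset_adjoin (Or.inl ⟨a, rfl⟩)
  have hc : ∀ α : t.Pos, t.ghost α ∈ t.reduced κ := fun α =>
    Algebra.subset_adjoin (Or.inr ⟨α, rfl⟩)
  induction hx using Algebra.adjoin_induction with
  | mem x hx =>
    rcases hx with ⟨a, rfl⟩ | ⟨α, rfl⟩
    · rw [t.d_hatCurrent hκ]
      exact sub_mem (sum_mem fun α _ => sum_mem fun γ _ =>
        Subalgebra.smul_mem _ (mul_mem (hJ γ) (hc α)) _)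
        (sum_mem fun α _ => sum_mem fun γ _ => Subalgebra.smul_mem _ (hc α) _)
    · rw [d_ghost]
      exact neg_mem (Subalgebra.smul_mem _ (sum_mem fun α _ => sum_mem fun γ _ =>
        Subalgebra.smul_mem _ (mul_mem (hc α) (hc γ)) _) _)
  | algebraMap r => rw [(t.brst κ e).d_algebraMap]; exact zero_mem _
  | add x y _ _ hx hy => rw [map_add]; exact add_mem hx hy
  | mul x y hx' hy' hx hy =>
    rw [d_mul]
    exact add_mem (mul_mem hx hy') (mul_mem (t.omegaParity_mem_reduced κ x hx') hy)

end HomogeneousBasis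

end Differential

/-! ### Spans of words in an associative algebra -/

section Words

variable {R : Type*} [Ring R] [Algebra ℂ R] {X : Type*}

/-- This allows induction on words by prepending one generator at a time, for a submodule S that
need not be closed under products. -/
theorem adjoin_le_of_mul_mem {s : Set R} {S : Submodule ℂ R} (h1 : 1 ∈ S)
    (h : ∀ x ∈ s, ∀ y ∈ S, x * y ∈ S) : Subalgebra.toSubmodule (Algebra.adjoin ℂ s) ≤ S := by
  have h2 : ∀ a ∈ Algebra.adjoin ℂ s, ∀ y ∈ S, a * y ∈ S := by
    intro a ha
    induction ha using Algebra.adjoin_induction with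
    | mem x hx => exact h x hx
    | algebraMap r =>
      intro y hy
      rw [← Algebra.smul_def]
      exact S.smul_mem _ hy
    | add x y _ _ hx hy => exact fun z hz => by rw [add_mul]; exact add_mem (hx z hz) (hy z hz)
    | mul x y _ _ hx hy => exact fun z hz => by rw [mul_assoc]; exact hx _ (hy z hz)
  exact fun a ha => by simpa using h2 a ha 1 h1

/-- The span of the words of length less than `k` in the letters `f x`. -/
def wordSpan (f : X → R) (k : ℕ) : Submodule ℂ R :=
  Submodule.span ℂ {w | ∃ l : List X, l.length < k ∧ w = (l.map f).prod}

variable {f : X → R}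

theorem prod_mem_wordSpan {l : List X} {k : ℕ} (h : l.length < k) :
    (l.map f).prod ∈ wordSpan f k :=
  Submodule.subset_span ⟨l, h, rfl⟩

theorem wordSpan_mono : Monotone (wordSpan f) := fun _ _ h =>
  Submodule.span_mono fun _ ⟨l, hl, hw⟩ => ⟨l, hl.trans_le h, hw⟩

theorem wordSpan_zero : wordSpan f 0 = ⊥ := by
  simp [wordSpan]

theorem letter_mul_mem_wordSpan (a : X) {k : ℕ} {w : R} (hw : w ∈ wordSpan f k) :
    f a * w ∈ wordSpan f (k + 1) := by
  induction hw using Submodule.span_induction with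
  | mem w hw =>
    obtain ⟨l, hl, rfl⟩ := hw
    exact Submodule.subset_span ⟨a :: l, by simpa using hl, by simp⟩
  | zero => simp
  | add x y _ _ hx hy => rw [mul_add]; exact add_mem hx hy
  | smul r x _ hx => rw [mul_smul_comm]; exact Submodule.smul_mem _ _ hx

/-- The truncated case k = 0 is harmless because the span of words of negative length is zero. -/
theorem letter_mul_mem_wordSpan_pred (a : X) {k : ℕ} {w : R} (hw : w ∈ wordSpan f (k - 1)) :
    f a * w ∈ wordSpan f k := by
  rcases k with _ | k
  · rw [Nat.zero_sub, wordSpan_zero, Submodule.mem_bot] at hw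
    simp [hw]
  · exact letter_mul_mem_wordSpan a hw

theorem mem_wordSpan_of_mem_adjoin {w : R} (hw : w ∈ Algebra.adjoin ℂ (Set.range f)) :
    ∃ k, w ∈ wordSpan f k := by
  have h : w ∈ ⨆ k, wordSpan f k := by
    refine adjoin_le_of_mul_mem (Submodule.mem_iSup_of_mem 1 (prod_mem_wordSpan (l := []) ?_))
      ?_ hw
    · simp
    · rintro _ ⟨a, rfl⟩ y hy
      rw [Submodule.mem_iSup_of_directed _ wordSpan_mono.directed_le] at hy
      obtain ⟨k, hk⟩ := hy
      exact Submodule.mem_iSup_of_mem _ (letter_mul_mem_wordSpan a hk)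
  rwa [Submodule.mem_iSup_of_directed _ wordSpan_mono.directed_le] at h

theorem span_mul_mem_wordSpan {k : ℕ} {u w : R} (hu : u ∈ Submodule.span ℂ (Set.range f))
    (hw : w ∈ wordSpan f k) : u * w ∈ wordSpan f (k + 1) := by
  induction hu using Submodule.span_induction with
  | mem u hu => obtain ⟨a, rfl⟩ := hu; exact letter_mul_mem_wordSpan a hw
  | zero => simp
  | add x y _ _ hx hy => rw [add_mul]; exact add_mem hx hy
  | smul r x _ hx => rw [smul_mul_assoc]; exact Submodule.smul_mem _ _ hx

variable (hf : ∀ a b, f a * f b - f b * f a ∈ Submodule.span ℂ (Set.range f))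

include hf

/-- If commutators of letters are linear, permuting a word changes it by shorter words. -/
theorem prod_sub_prod_mem_wordSpan {l m : List X} (h : l.Perm m) :
    (l.map f).prod - (m.map f).prod ∈ wordSpan f l.length := by
  induction h with
  | nil => simp
  | cons a _ ih =>
    simp only [List.map_cons, List.prod_cons, ← mul_sub]
    exact letter_mul_mem_wordSpan a ih
  | swap a b l =>
    simp only [List.map_cons, List.prod_cons, ← mul_assoc, ← sub_mul]
    exact span_mul_mem_wordSpan (hf b a) (prod_mem_wordSpan (Nat.lt_succ_self _))
  | trans h1 _ ih1 ih2 =>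
    rw [← h1.length_eq] at ih2
    simpa using add_mem ih1 ih2

/-- If commutators of letters are linear, words are combinations of words chosen one for each
multiset of letters. -/
theorem wordSpan_le_span_multiset (k : ℕ) : wordSpan f k ≤
    Submodule.span ℂ (Set.range fun σ : Multiset X => (σ.toList.map f).prod) := by
  induction k with
  | zero => simp [wordSpan_zero]
  | succ k ih =>
    refine Submodule.span_le.2 ?_
    rintro _ ⟨l, hl, rfl⟩
    have h : l.Perm (l : Multiset X).toList :=
      Multiset.coe_eq_coe.1 (Multiset.coe_toList _).symm
    have h1 := ih (wordSpan_mono (Nat.lt_succ_iff.1 hl) (prod_sub_prod_mem_wordSpan hf h))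
    rw [SetLike.mem_coe, ← sub_add_cancel (l.map f).prod (((l : Multiset X).toList).map f).prod]
    exact add_mem h1 (Submodule.subset_span ⟨_, rfl⟩)

theorem mem_span_multiset {u : R} (hu : u ∈ Algebra.adjoin ℂ (Set.range f)) :
    u ∈ Submodule.span ℂ (Set.range fun σ : Multiset X => (σ.toList.map f).prod) := by
  obtain ⟨k, hk⟩ := mem_wordSpan_of_mem_adjoin hu
  exact wordSpan_le_span_multiset hf k hk

end Words

/-! ### Differential operators on the universal enveloping algebra -/

section Enveloping

variable {L : Type*} [LieRing L] [LieAlgebra ℂ L]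

local notation "U" => UniversalEnvelopingAlgebra ℂ L
local notation "ι" => UniversalEnvelopingAlgebra.ι ℂ

/-- The homomorphism from the universal enveloping algebra extending a linear map that sends
brackets to commutators. -/
noncomputable def envelopingLift {A : Type*} [Ring A] [Algebra ℂ A] (f : L →ₗ[ℂ] A)
    (hf : ∀ x y, f ⁅x, y⁆ = f x * f y - f y * f x) : UniversalEnvelopingAlgebra ℂ L →ₐ[ℂ] A :=
  letI : LieRing A := LieRing.ofAssociativeRing
  UniversalEnvelopingAlgebra.lift ℂ ({ f with map_lie' := fun {x y} => hf x y } : L →ₗ⁅ℂ⁆ A)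

theorem envelopingLift_ι {A : Type*} [Ring A] [Algebra ℂ A] (f : L →ₗ[ℂ] A)
    (hf : ∀ x y, f ⁅x, y⁆ = f x * f y - f y * f x) (x : L) : envelopingLift f hf (ι x) = f x := by
  let _ : LieRing A := LieRing.ofAssociativeRing
  exact UniversalEnvelopingAlgebra.lift_ι_apply ℂ
    ({ f with map_lie' := fun {x y} => hf x y } : L →ₗ⁅ℂ⁆ A) x

/-- The coproduct, for which the elements of the Lie algebra are primitive. -/
noncomputable def coproduct : U →ₐ[ℂ] U ⊗[ℂ] U :=
  envelopingLift
    { toFun := fun x => ι x ⊗ₜ 1 + 1 ⊗ₜ ι x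
      map_add' := fun x y => by
        rw [map_add, TensorProduct.add_tmul, TensorProduct.tmul_add]; abel
      map_smul' := fun r x => by
        rw [map_smul, TensorProduct.tmul_smul, ← TensorProduct.smul_tmul', smul_add,
          RingHom.id_apply] }
    fun x y => by
      simp only [LinearMap.coe_mk, AddHom.coe_mk, ι_lie, TensorProduct.sub_tmul,
        TensorProduct.tmul_sub, add_mul, mul_add, Algebra.TensorProduct.tmul_mul_tmul, one_mul,
        mul_one]
      abel

theorem coproduct_ι (x : L) : coproduct (ι x) = ι x ⊗ₜ 1 + 1 ⊗ₜ ι x :=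
  envelopingLift_ι _ _ x

/-- The counit. -/
noncomputable def counit : U →ₐ[ℂ] ℂ := envelopingLift 0 (by simp)

theorem counit_ι (x : L) : counit (ι x) = 0 := envelopingLift_ι _ _ x

/-- The operator `u ↦ (1 ⊗ ψ)(Δ u)`, a differential operator on the group. -/
noncomputable def diffOp (ψ : Module.Dual ℂ U) : Module.End ℂ U :=
  (TensorProduct.rid ℂ U).toLinearMap ∘ₗ LinearMap.lTensor U ψ ∘ₗ coproduct.toLinearMap

theorem diffOp_one (ψ : Module.Dual ℂ U) : diffOp ψ 1 = ψ 1 • 1 := by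
  simp [diffOp, Algebra.TensorProduct.one_def]

theorem diffOp_add (ψ χ : Module.Dual ℂ U) : diffOp (ψ + χ) = diffOp ψ + diffOp χ := by
  simp [diffOp, LinearMap.lTensor_add, LinearMap.add_comp, LinearMap.comp_add]

theorem diffOp_smul (r : ℂ) (ψ : Module.Dual ℂ U) : diffOp (r • ψ) = r • diffOp ψ := by
  simp [diffOp, LinearMap.lTensor_smul, LinearMap.smul_comp, LinearMap.comp_smul]

/-- A Leibniz rule, expressing that x is primitive: either x stays in the first tensor factor or it
is absorbed into the functional. -/
theorem diffOp_ι_mul (ψ : Module.Dual ℂ U) (x : L) (u : U) :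
    diffOp ψ (ι x * u) = ι x * diffOp ψ u + diffOp (ψ ∘ₗ LinearMap.mulLeft ℂ (ι x)) u := by
  simp only [diffOp, LinearMap.comp_apply, AlgHom.toLinearMap_apply, map_mul, coproduct_ι, add_mul,
    map_add, LinearEquiv.coe_coe]
  generalize coproduct u = w
  congr 1 <;> induction w using TensorProduct.induction_on with
  | zero => simp
  | tmul a b => simp
  | add a b ha hb => simp only [mul_add, map_add, ha, hb]

theorem diffOp_counit : diffOp (counit (L := L)).toLinearMap = LinearMap.id := by
  have h : Subalgebra.toSubmodule (Algebra.adjoin ℂ (Set.range (ι : L → U))) ≤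
      LinearMap.eqLocus (diffOp (counit (L := L)).toLinearMap) LinearMap.id := by
    refine adjoin_le_of_mul_mem (by simp [diffOp_one]) ?_
    rintro _ ⟨x, rfl⟩ u hu
    rw [LinearMap.mem_eqLocus] at hu ⊢
    have h0 : (counit (L := L)).toLinearMap ∘ₗ LinearMap.mulLeft ℂ (ι x) = 0 := by
      ext u
      rw [LinearMap.comp_apply, LinearMap.mulLeft_apply, AlgHom.toLinearMap_apply, map_mul,
        counit_ι, zero_mul, LinearMap.zero_apply]
    rw [diffOp_ι_mul, hu, h0]
    simp [diffOp]
  rw [adjoin_range_ι_eq_top] at h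
  refine LinearMap.ext fun u => h ?_
  rw [Algebra.top_toSubmodule]
  exact Submodule.mem_top

variable {X : Type*} (v : X → L)

theorem diffOp_prod_mem (ψ : Module.Dual ℂ U) (l : List X) :
    diffOp ψ (l.map fun x => ι (v x)).prod ∈ wordSpan (fun x => ι (v x)) (l.length + 1) := by
  induction l generalizing ψ with
  | nil =>
    simp only [List.map_nil, List.prod_nil, diffOp_one]
    exact Submodule.smul_mem _ _ (prod_mem_wordSpan (f := fun x => ι (v x)) (l := []) (by simp))
  | cons a l ih =>
    rw [List.map_cons, List.prod_cons, diffOp_ι_mul]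
    exact add_mem (letter_mul_mem_wordSpan (f := fun x => ι (v x)) a (ih _))
      (wordSpan_mono (Nat.le_succ _) (ih _))

/-- The only term that keeps all letters has coefficient ψ(1); without it the operator strictly
lowers the length. -/
theorem diffOp_prod_mem_of_map_one (ψ : Module.Dual ℂ U) (hψ : ψ 1 = 0) (l : List X) :
    diffOp ψ (l.map fun x => ι (v x)).prod ∈ wordSpan (fun x => ι (v x)) l.length := by
  induction l with
  | nil => simp [diffOp_one, hψ]
  | cons a l ih =>
    rw [List.map_cons, List.prod_cons, diffOp_ι_mul]
    exact add_mem (letter_mul_mem_wordSpan (f := fun x => ι (v x)) a ih) (diffOp_prod_mem v _ l)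

/-- Splitting off the constant part of a functional: `D_ψ = ψ(1) + D_{ψ - ψ(1) ε}`. -/
theorem diffOp_eq (ψ : Module.Dual ℂ U) (u : U) :
    diffOp ψ u = ψ 1 • u + diffOp (ψ - ψ 1 • counit.toLinearMap) u := by
  conv_lhs => rw [show ψ = ψ 1 • counit.toLinearMap + (ψ - ψ 1 • counit.toLinearMap) by abel]
  rw [diffOp_add, diffOp_smul, diffOp_counit]
  rfl

variable [DecidableEq X] (hv : ∀ a b, ⁅v a, v b⁆ ∈ Submodule.span ℂ (Set.range v))
  (φ : X → Module.Dual ℂ (UniversalEnvelopingAlgebra ℂ L)) (hφ1 : ∀ a, (φ a) 1 = 0)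
  (hφ : ∀ a b, φ a (ι (v b)) = if a = b then 1 else 0)

include hv in
omit [DecidableEq X] in
theorem commutator_mem_span (a b : X) : ι (v a) * ι (v b) - ι (v b) * ι (v a) ∈
    Submodule.span ℂ (Set.range fun x => ι (v x)) := by
  rw [← ι_lie]
  let _ : LieRing U := LieRing.ofAssociativeRing
  have h := Submodule.mem_map_of_mem (f := (ι : L →ₗ⁅ℂ⁆ U).toLinearMap) (hv a b)
  rwa [Submodule.map_span, ← Set.range_comp] at h

include hv hφ1 hφ

/-- Up to shorter words, `D_{φ a}` acts on words as the derivation sending the letter `a` to `1` and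
the others to `0`. -/
theorem diffOp_prod_sub_mem (a : X) (l : List X) :
    diffOp (φ a) (l.map fun x => ι (v x)).prod -
      (l.count a : ℂ) • ((l.erase a).map fun x => ι (v x)).prod ∈
        wordSpan (fun x => ι (v x)) (l.length - 1) := by
  induction l with
  | nil => simp [diffOp_one, hφ1]
  | cons b l ih =>
    set f := fun x => ι (v x) with hf
    -- The constant part of this functional is φ_a(v_b) = δ_ab: it contributes the tail exactly when
    -- the letter b equals a. The rest lowers the length.
    have h1 := diffOp_eq (φ a ∘ₗ LinearMap.mulLeft ℂ (ι (v b))) (l.map f).prod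
    set ψ := φ a ∘ₗ LinearMap.mulLeft ℂ (ι (v b))
    have hψ : ψ 1 = if a = b then 1 else 0 := by simp only [ψ, LinearMap.comp_apply,
      LinearMap.mulLeft_apply, mul_one, hφ]
    have h2 := diffOp_prod_mem_of_map_one v (ψ - ψ 1 • counit.toLinearMap) (by simp) l
    have h3 := add_mem (letter_mul_mem_wordSpan_pred b ih) h2
    rw [List.map_cons, List.prod_cons, diffOp_ι_mul, h1, List.length_cons, Nat.add_sub_cancel]
    rw [hψ] at h3 ⊢
    by_cases hab : a = b
    · subst hab
      rw [if_pos rfl] at h3 ⊢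
      rw [List.count_cons_self, List.erase_cons_head]
      -- Erasing a later occurrence of a and keeping the first gives a permutation of the tail,
      -- hence the same word up to shorter ones.
      have h4 : (l.count a : ℂ) • (f a * ((l.erase a).map f).prod - (l.map f).prod) ∈
          wordSpan f l.length := by
        by_cases ha : a ∈ l
        · have h5 := prod_sub_prod_mem_wordSpan (commutator_mem_span v hv)
            (List.perm_cons_erase ha)
          rw [← neg_mem_iff, ← smul_neg, neg_sub, ← List.prod_cons, ← List.map_cons]
          exact Submodule.smul_mem _ _ h5
        · simp [List.count_eq_zero_of_not_mem ha]
      convert add_mem h3 h4 using 1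
      push_cast
      simp only [mul_sub, mul_smul_comm, smul_sub, add_smul, one_smul, hf]
      abel
    · rw [if_neg hab] at h3 ⊢
      rw [List.count_cons_of_ne (Ne.symm hab), List.erase_cons_tail (by simpa using Ne.symm hab),
        List.map_cons, List.prod_cons]
      convert h3 using 1
      simp only [mul_sub, mul_smul_comm, zero_smul, zero_add, hf]
      abel

/-- The functional `ε ∘ D_{φ aₖ} ∘ ⋯ ∘ D_{φ a₁}`. -/
theorem exists_dual_of_list (l : List X) : ∃ Φ : Module.Dual ℂ U,
    (∀ w ∈ wordSpan (fun x => ι (v x)) l.length, Φ w = 0) ∧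
    ∀ m : List X, m.length = l.length → ((Φ (m.map fun x => ι (v x)).prod ≠ 0) ↔ l.Perm m) := by
  induction l with
  | nil =>
    refine ⟨counit.toLinearMap, fun w hw => ?_, fun m hm => ?_⟩
    · rw [List.length_nil, wordSpan_zero, Submodule.mem_bot] at hw
      simp [hw]
    · rw [List.length_nil, List.length_eq_zero_iff] at hm
      simp [hm]
  | cons a l ih =>
    obtain ⟨Φ, h0, h1⟩ := ih
    refine ⟨Φ ∘ₗ diffOp (φ a), fun w hw => ?_, fun m hm => ?_⟩
    · induction hw using Submodule.span_induction with
      | mem w hw =>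
        obtain ⟨m, hm, rfl⟩ := hw
        rw [List.length_cons, Nat.lt_succ_iff] at hm
        exact h0 _ (wordSpan_mono hm (diffOp_prod_mem_of_map_one v _ (hφ1 a) m))
      | zero => simp
      | add x y _ _ hx hy => rw [map_add, hx, hy, add_zero]
      | smul r x _ hx => rw [map_smul, hx, smul_zero]
    · have h2 := diffOp_prod_sub_mem v hv φ hφ1 hφ a m
      rw [hm, List.length_cons, Nat.add_sub_cancel] at h2
      have h3 := h0 _ h2
      rw [map_sub, sub_eq_zero, map_smul, smul_eq_mul] at h3
      rw [LinearMap.comp_apply, h3, List.cons_perm_iff_perm_erase]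
      by_cases ha : a ∈ m
      · have h4 := h1 (m.erase a) (by rw [List.length_erase_of_mem ha, hm]; simp)
        -- Characteristic zero enters here: the multiplicities produced by differentiation do not
        -- vanish.
        have h5 : (m.count a : ℂ) ≠ 0 := Nat.cast_ne_zero.2 (List.count_pos_iff.2 ha).ne'
        rw [← h4, mul_ne_zero_iff]
        exact ⟨fun h => ⟨ha, h.2⟩, fun h => ⟨h5, h.2⟩⟩
      · rw [List.count_eq_zero_of_not_mem ha, Nat.cast_zero, zero_mul]
        exact ⟨fun h => absurd rfl h, fun h => absurd h.1 ha⟩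

/-- The Poincaré-Birkhoff-Witt theorem: words with distinct multisets of letters are linearly
independent. -/
theorem linearIndependent_words {J : Type*} (ℓ : J → List X)
    (hℓ : Function.Injective fun j => (ℓ j : Multiset X)) :
    LinearIndependent ℂ fun j => ((ℓ j).map fun x => ι (v x)).prod := by
  rw [linearIndependent_iff']
  intro s g hg
  by_contra! h
  obtain ⟨i, hi, hgi⟩ := h
  -- Triangularity: the functional of a longest word occurring in the relation kills all shorter
  -- words and all other words of the same length.
  obtain ⟨j, hj, hmax⟩ := (s.filter fun i => g i ≠ 0).exists_max_image (fun i => (ℓ i).length)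
    ⟨i, by simp [hi, hgi]⟩
  rw [Finset.mem_filter] at hj
  obtain ⟨Φ, h0, h1⟩ := exists_dual_of_list v hv φ hφ1 hφ (ℓ j)
  have h2 := congr_arg Φ hg
  rw [map_sum, map_zero, Finset.sum_eq_single_of_mem j hj.1] at h2
  · rw [map_smul, smul_eq_mul] at h2
    exact mul_ne_zero hj.2 ((h1 _ rfl).2 (List.Perm.refl _)) h2
  · intro b hb hbj
    by_cases hgb : g b = 0
    · simp [hgb]
    · rw [map_smul]
      have h3 := hmax b (by simp [hb, hgb])
      rcases h3.lt_or_eq with h3 | h3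
      · rw [h0 _ (prod_mem_wordSpan h3), smul_zero]
      · have h4 := (h1 (ℓ b) h3).not.2 fun hp => hbj (hℓ (Multiset.coe_eq_coe.2 hp.symm))
        rw [not_not] at h4
        rw [h4, smul_zero]

/-- Any linear map on `U(n)` extends to a left `U(p)`-linear map on `U(p ⊕ n)`. -/
theorem exists_linear_extension (p q : X → Prop) (hpq : ∀ x, ¬ (p x ∧ q x))
    (hp : ∀ a b : {x // p x}, ⁅v a, v b⁆ ∈ Submodule.span ℂ (Set.range fun x : {x // p x} => v x))
    (hq : ∀ a b : {x // q x}, ⁅v a, v b⁆ ∈ Submodule.span ℂ (Set.range fun x : {x // q x} => v x))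
    (D : Module.End ℂ U) : ∃ E : Module.End ℂ U,
      ∀ x ∈ Algebra.adjoin ℂ (Set.range fun a : {x // p x} => ι (v a)),
      ∀ y ∈ Algebra.adjoin ℂ (Set.range fun a : {x // q x} => ι (v a)), E (x * y) = x * D y := by
  classical
  -- Ordered monomials: letters of type p first. As p and q exclude each other, filtering by p
  -- recovers both multisets, so these words are independent.
  let ℓ : Multiset {x // p x} × Multiset {x // q x} → List X := fun σ =>
    σ.1.toList.map Subtype.val ++ σ.2.toList.map Subtype.val
  have hℓ : Function.Injective fun j => (ℓ j : Multiset X) := by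
    have h1 : ∀ j, (ℓ j : Multiset X) = j.1.map Subtype.val + j.2.map Subtype.val := fun j => by
      rw [← Multiset.coe_add, ← Multiset.map_coe, ← Multiset.map_coe, Multiset.coe_toList,
        Multiset.coe_toList]
    have h2 : ∀ j, (ℓ j : Multiset X).filter p = j.1.map Subtype.val := fun j => by
      rw [h1, Multiset.filter_add, Multiset.filter_eq_self.2, Multiset.filter_eq_nil.2, add_zero]
      · intro a ha hpa
        obtain ⟨b, -, rfl⟩ := Multiset.mem_map.1 ha
        exact hpq _ ⟨hpa, b.2⟩
      · intro a ha
        obtain ⟨b, -, rfl⟩ := Multiset.mem_map.1 ha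
        exact b.2
    intro j k hjk
    have h3 : j.1 = k.1 := Multiset.map_injective Subtype.val_injective (by
      rw [← h2, ← h2]; exact congr_arg _ hjk)
    refine Prod.ext h3 (Multiset.map_injective Subtype.val_injective ?_)
    have h4 : (ℓ j : Multiset X) = ℓ k := hjk
    rwa [h1, h1, h3, add_right_inj] at h4
  have hli := linearIndependent_words v hv φ hφ1 hφ ℓ hℓ
  -- E is prescribed on the independent ordered monomials and extended arbitrarily; bilinearity then
  -- gives the identity for all x and y.
  obtain ⟨E, hE⟩ := LinearMap.exists_extend ((Module.Basis.span hli).constr ℂ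
    fun σ => (σ.1.toList.map fun x : {x // p x} => ι (v x)).prod *
      D (σ.2.toList.map fun x : {x // q x} => ι (v x)).prod)
  have hE' : ∀ σ : Multiset {x // p x} × Multiset {x // q x},
      E ((σ.1.toList.map fun x : {x // p x} => ι (v x)).prod *
          (σ.2.toList.map fun x : {x // q x} => ι (v x)).prod) =
        (σ.1.toList.map fun x : {x // p x} => ι (v x)).prod *
          D (σ.2.toList.map fun x : {x // q x} => ι (v x)).prod :=
    fun σ => by
      have h := LinearMap.congr_fun hE (Module.Basis.span hli σ)
      rw [Module.Basis.constr_basis, LinearMap.comp_apply, Submodule.subtype_apply,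
        Module.Basis.span_apply] at h
      rw [← h]
      congr 1
      simp only [ℓ, List.map_append, List.prod_append, List.map_map]
      rfl
  refine ⟨E, fun x hx y hy => ?_⟩
  replace hx := mem_span_multiset (commutator_mem_span (fun a : {x // p x} => v a) hp) hx
  replace hy := mem_span_multiset (commutator_mem_span (fun a : {x // q x} => v a) hq) hy
  induction hx using Submodule.span_induction with
  | mem x hx =>
    obtain ⟨σ, rfl⟩ := hx
    induction hy using Submodule.span_induction with
    | mem y hy => obtain ⟨τ, rfl⟩ := hy; exact hE' (σ, τ)
    | zero => simp
    | add y z _ _ hy hz => simp only [mul_add, map_add, hy, hz]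
    | smul r y _ hy => simp only [mul_smul_comm, map_smul, hy]
  | zero => simp
  | add x z _ _ hx hz => simp only [add_mul, map_add, hx, hz]
  | smul r x _ hx => simp only [smul_mul_assoc, map_smul, hx]

end Enveloping

/-! ### Contraction of the complement of `Ω_red` -/

section Exchange

variable {R : Type*} [Ring R] [Algebra ℂ R]

/-- An element of E is moved past a product one generator at a time; what emerges on the right is
again in E, so the process can continue. -/
theorem mul_mem_of_exchange {s : Set R} {E : Submodule ℂ R}
    (h : ∀ e ∈ E, ∀ r ∈ s, e * r ∈ Subalgebra.toSubmodule (Algebra.adjoin ℂ s) * E) :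
    ∀ e ∈ E, ∀ r ∈ Algebra.adjoin ℂ s,
      e * r ∈ Subalgebra.toSubmodule (Algebra.adjoin ℂ s) * E := by
  set A := Algebra.adjoin ℂ s
  intro e he r hr
  induction hr using Algebra.adjoin_induction generalizing e with
  | mem r hr => exact h e he r hr
  | algebraMap c =>
    rw [← Algebra.commutes]
    exact Submodule.mul_mem_mul (A.algebraMap_mem c) he
  | add r r' _ _ hr hr' => rw [mul_add]; exact add_mem (hr e he) (hr' e he)
  | mul r r' _ _ hr hr' =>
    rw [← mul_assoc]
    refine Submodule.mul_induction_on (hr e he) (fun a ha e' he' => ?_) fun x y hx hy => ?_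
    · rw [mul_assoc]
      have h1 := Submodule.mul_mem_mul (show a ∈ Subalgebra.toSubmodule A from ha) (hr' e' he')
      rwa [← mul_assoc (Subalgebra.toSubmodule A), A.isIdempotentElem_toSubmodule.eq] at h1
    · rw [add_mul]; exact add_mem hx hy

/-- The product contains 1 and is stable under left multiplication by all generators: those in `s`
are absorbed on the left, those in `s'` are moved through to the right. -/
theorem adjoin_mul_adjoin_eq_top {s s' : Set R} (hs : Algebra.adjoin ℂ (s ∪ s') = ⊤)
    {E : Submodule ℂ R} (hE : E ≤ Subalgebra.toSubmodule (Algebra.adjoin ℂ s'))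
    (h : ∀ e ∈ s', ∀ r ∈ Algebra.adjoin ℂ s,
      e * r ∈ Subalgebra.toSubmodule (Algebra.adjoin ℂ s) * E) :
    Subalgebra.toSubmodule (Algebra.adjoin ℂ s) * Subalgebra.toSubmodule (Algebra.adjoin ℂ s') =
      ⊤ := by
  set A := Algebra.adjoin ℂ s
  set N := Algebra.adjoin ℂ s'
  rw [eq_top_iff, ← Algebra.top_toSubmodule, ← hs]
  refine adjoin_le_of_mul_mem ?_ ?_
  · have := Submodule.mul_mem_mul (show (1 : R) ∈ Subalgebra.toSubmodule A from A.one_mem)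
      (show (1 : R) ∈ Subalgebra.toSubmodule N from N.one_mem)
    rwa [mul_one] at this
  · rintro x hx y hy
    induction hy using Submodule.mul_induction_on' with
    | mem_mul_mem a ha n hn =>
      rw [← mul_assoc]
      rcases hx with hx | hx
      · exact Submodule.mul_mem_mul (A.mul_mem (Algebra.subset_adjoin hx) ha) hn
      · have h1 := Submodule.mul_mem_mul (mul_le_mul_right hE _ (h x hx a ha)) hn
        rwa [mul_assoc, N.isIdempotentElem_toSubmodule.eq] at h1
    | add y _ z _ hy hz => rw [mul_add]; exact add_mem hy hz

end Exchange

/-! ### The letters `d b^α`, `b^α` and differential operators on Ω. -/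

section Contraction

variable {L : Type*} [LieRing L] [LieAlgebra ℂ L]

/-- The operator `D_ψ ⊗ 1` on `Ω`. -/
noncomputable def omegaDiffOp (δ : L) (ψ : Module.Dual ℂ (UniversalEnvelopingAlgebra ℂ L)) :
    Module.End ℂ (Omega δ) :=
  TensorProduct.map (diffOp ψ) LinearMap.id

theorem omegaDiffOp_one (δ : L) (ψ : Module.Dual ℂ (UniversalEnvelopingAlgebra ℂ L)) :
    omegaDiffOp δ ψ 1 = ψ 1 • 1 := by
  rw [omegaDiffOp, Algebra.TensorProduct.one_def, TensorProduct.map_tmul, diffOp_one,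
    TensorProduct.smul_tmul', LinearMap.id_apply]

theorem map_tmul_one_mul (δ : L) (E : Module.End ℂ (UniversalEnvelopingAlgebra ℂ L))
    (x : GhostAlgebra δ) (w : Omega δ) :
    (TensorProduct.map E LinearMap.id : Module.End ℂ (Omega δ)) ((1 ⊗ₜ x) * w) =
      (1 ⊗ₜ x) * TensorProduct.map E LinearMap.id w := by
  induction w using TensorProduct.induction_on with
  | zero => simp
  | tmul a b => simp
  | add a b ha hb => simp only [mul_add, map_add, ha, hb]

theorem omegaDiffOp_currentMap_mul (δ : L) (ψ : Module.Dual ℂ (UniversalEnvelopingAlgebra ℂ L))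
    (x : L) (w : Omega δ) : omegaDiffOp δ ψ (currentMap δ x * w) =
      currentMap δ x * omegaDiffOp δ ψ w +
        omegaDiffOp δ (ψ ∘ₗ LinearMap.mulLeft ℂ (UniversalEnvelopingAlgebra.ι ℂ x)) w := by
  induction w using TensorProduct.induction_on with
  | zero => simp
  | tmul a b =>
    simp only [omegaDiffOp, currentMap_apply, Algebra.TensorProduct.tmul_mul_tmul,
      TensorProduct.map_tmul, diffOp_ι_mul, one_mul, TensorProduct.add_tmul, LinearMap.id_apply]
  | add a b ha hb =>
    simp only [mul_add, map_add, ha, hb]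
    abel

theorem omegaDiffOp_eq (δ : L) (ψ : Module.Dual ℂ (UniversalEnvelopingAlgebra ℂ L))
    (w : Omega δ) : omegaDiffOp δ ψ w =
      ψ 1 • w + omegaDiffOp δ (ψ - ψ 1 • counit.toLinearMap) w := by
  induction w using TensorProduct.induction_on with
  | zero => simp
  | tmul a b =>
    rw [omegaDiffOp, omegaDiffOp, TensorProduct.map_tmul, TensorProduct.map_tmul, diffOp_eq,
      TensorProduct.add_tmul, TensorProduct.smul_tmul', LinearMap.id_apply]
  | add a b ha hb =>
    simp only [map_add, ha, hb, smul_add]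
    abel

theorem map_mem_omegaDegree {δ : L} (E : Module.End ℂ (UniversalEnvelopingAlgebra ℂ L)) {k : ℤ}
    {x : Omega δ} (hx : x ∈ omegaDegree δ k) :
    (TensorProduct.map E LinearMap.id : Module.End ℂ (Omega δ)) x ∈ omegaDegree δ k := by
  induction hx using Submodule.span_induction with
  | mem x hx =>
    obtain ⟨u, l, hl, rfl⟩ := hx
    exact Submodule.subset_span ⟨E u, l, hl, rfl⟩
  | zero => simp
  | add x y _ _ hx hy => rw [map_add]; exact add_mem hx hy
  | smul r x _ hx => rw [map_smul]; exact Submodule.smul_mem _ _ hx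

/-- The span of the `u ⊗ x` with `u` in a subalgebra of the enveloping algebra. -/
def tensorSpan (δ : L) (S : Subalgebra ℂ (UniversalEnvelopingAlgebra ℂ L)) :
    Submodule ℂ (Omega δ) :=
  Submodule.span ℂ {w | ∃ u ∈ S, ∃ x, w = u ⊗ₜ x}

theorem tmul_mul_mem_tensorSpan {δ : L} {S : Subalgebra ℂ (UniversalEnvelopingAlgebra ℂ L)}
    {u : UniversalEnvelopingAlgebra ℂ L} (hu : u ∈ S) (x : GhostAlgebra δ) {w : Omega δ}
    (hw : w ∈ tensorSpan δ S) : (u ⊗ₜ x) * w ∈ tensorSpan δ S := by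
  induction hw using Submodule.span_induction with
  | mem w hw =>
    obtain ⟨v, hv, y, rfl⟩ := hw
    exact Submodule.subset_span ⟨u * v, S.mul_mem hu hv, x * y, by simp⟩
  | zero => simp
  | add x y _ _ hx hy => rw [mul_add]; exact add_mem hx hy
  | smul r x _ hx => rw [mul_smul_comm]; exact Submodule.smul_mem _ _ hx

theorem one_mem_tensorSpan (δ : L) (S : Subalgebra ℂ (UniversalEnvelopingAlgebra ℂ L)) :
    (1 : Omega δ) ∈ tensorSpan δ S :=
  Submodule.subset_span ⟨1, S.one_mem, 1, rfl⟩

theorem map_mul_of_mem_tensorSpan {δ : L} {S T : Subalgebra ℂ (UniversalEnvelopingAlgebra ℂ L)}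
    {E D : Module.End ℂ (UniversalEnvelopingAlgebra ℂ L)}
    (h : ∀ x ∈ S, ∀ y ∈ T, E (x * y) = x * D y) {r w : Omega δ} (hr : r ∈ tensorSpan δ S)
    (hw : w ∈ tensorSpan δ T) :
    (TensorProduct.map E LinearMap.id : Module.End ℂ (Omega δ)) (r * w) =
      r * TensorProduct.map D LinearMap.id w := by
  induction hr using Submodule.span_induction with
  | mem r hr =>
    obtain ⟨u, hu, x, rfl⟩ := hr
    induction hw using Submodule.span_induction with
    | mem w hw =>
      obtain ⟨v, hv, y, rfl⟩ := hw
      simp [h u hu v hv]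
    | zero => simp
    | add y z _ _ hy hz => simp only [mul_add, map_add, hy, hz]
    | smul r y _ hy => simp only [mul_smul_comm, map_smul, hy]
  | zero => simp
  | add x z _ _ hx hz => simp only [add_mul, map_add, hx, hz]
  | smul r x _ hx => simp only [smul_mul_assoc, map_smul, hx]

namespace HomogeneousBasis

variable {δ : L} {I : Type*} (t : HomogeneousBasis δ I) [Fintype I] [DecidableEq I]
  (κ : LinearMap.BilinForm ℂ L)

/-- The generators `d(b^α)` and `b^α` of the contractible part of `Ω`. -/
noncomputable def letter (e : L) : t.Pos ⊕ t.Pos → Omega δ :=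
  Sum.elim (fun α => t.d κ e (t.antighost α)) t.antighost

/-- The operator `X ↦ ∑ σ(F_α X) b^α`. -/
noncomputable def contraction (F : t.Pos → Module.End ℂ (Omega δ)) : Module.End ℂ (Omega δ) :=
  ∑ α, LinearMap.mulRight ℂ (t.antighost α) ∘ₗ (omegaParity δ).toLinearMap ∘ₗ F α

omit [DecidableEq I] in
theorem contraction_apply (F : t.Pos → Module.End ℂ (Omega δ)) (x : Omega δ) :
    t.contraction F x = ∑ α, omegaParity δ (F α x) * t.antighost α := by
  simp [contraction]

omit [DecidableEq I] in
theorem contraction_mem_omegaDegree {F : t.Pos → Module.End ℂ (Omega δ)} {k : ℤ}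
    (hF : ∀ α, ∀ x ∈ omegaDegree δ k, F α x ∈ omegaDegree δ k) {x : Omega δ}
    (hx : x ∈ omegaDegree δ k) : t.contraction F x ∈ omegaDegree δ (k - 1) := by
  rw [contraction_apply]
  exact sum_mem fun α _ => mul_mem_omegaDegree (parity_mem_omegaDegree (hF α x hx))
    (t.antighost_mem_omegaDegree α) rfl

variable {κ} (hκ : IsInvariantMetric κ) {e : L} (he : ⁅δ, e⁆ = e)

/-- The current commutes with antighosts, and contracting the ghost in Ĵ^a leaves one antighost: Ĵ
acts on antighosts through the bracket. -/
theorem hatCurrent_mul_antighost (a : I) (β : t.Pos) :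
    t.hatCurrent κ a * t.antighost β - t.antighost β * t.hatCurrent κ a =
      antighostMap δ κ ⁅t.upper κ a, t.upper κ β⁆ := by
  have h1 : ∀ ν : t.Pos, ∀ x : L, antighostMap δ κ x * t.ghost ν * t.antighost β -
      t.antighost β * (antighostMap δ κ x * t.ghost ν) =
        if β = ν then antighostMap δ κ x else 0 := fun ν x => by
    have h2 : t.ghost ν * t.antighost β = (if β = ν then 1 else 0) - t.antighost β * t.ghost ν := by
      rw [t.antighost_mul_ghost, sub_sub_cancel]
    rw [mul_assoc, h2, mul_sub, ← mul_assoc, t.antighostMap_mul_antighost]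
    split_ifs <;> noncomm_ring
  rw [hatCurrent_eq, hatMap_apply, add_mul, mul_add, ← current_eq, t.current_mul_antighost,
    add_sub_add_left_eq_sub, Finset.sum_mul, Finset.mul_sum, ← Finset.sum_sub_distrib]
  simp [h1]

theorem omegaParity_letter_inl (β : t.Pos) :
    omegaParity δ (t.letter κ e (.inl β)) = t.letter κ e (.inl β) := by
  simp only [letter, Sum.elim_inl, d_antighost, map_sub, omegaParity_hatCurrent, AlgHom.commutes]

theorem antighostMap_mem_span (x : L) :
    antighostMap δ κ x ∈ Submodule.span ℂ (Set.range (t.letter κ e)) := by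
  rw [t.antighostMap_eq_sum]
  exact sum_mem fun γ _ => Submodule.smul_mem _ _ (Submodule.subset_span ⟨.inr γ, rfl⟩)

theorem d_antighostMap_mem_span (x : L) :
    t.d κ e (antighostMap δ κ x) ∈ Submodule.span ℂ (Set.range (t.letter κ e)) := by
  rw [t.antighostMap_eq_sum, map_sum]
  simp only [map_smul]
  exact sum_mem fun γ _ => Submodule.smul_mem _ _ (Submodule.subset_span ⟨.inl γ, rfl⟩)

theorem letter_inl_mul_antighost (α β : t.Pos) :
    t.letter κ e (.inl α) * t.antighost β - t.antighost β * t.letter κ e (.inl α) =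
      antighostMap δ κ ⁅t.upper κ α, t.upper κ β⁆ := by
  simp only [letter, Sum.elim_inl, d_antighost, sub_mul, mul_sub]
  rw [← Algebra.commutes, sub_sub_sub_cancel_right, hatCurrent_mul_antighost]

-- Apply d to the commutator of `d b^α` with `b^β`; since d² = 0, it becomes the commutator of the
-- two coboundaries.
include hκ he in
theorem letter_inl_mul_letter_inl (α β : t.Pos) :
    t.letter κ e (.inl α) * t.letter κ e (.inl β) - t.letter κ e (.inl β) * t.letter κ e (.inl α) ∈
      Submodule.span ℂ (Set.range (t.letter κ e)) := by
  have h := congr_arg (t.d κ e) (t.letter_inl_mul_antighost (κ := κ) (e := e) α β)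
  rw [map_sub, d_mul, d_mul, omegaParity_letter_inl, omegaParity_antighost] at h
  have h0 : t.d κ e (t.letter κ e (.inl α)) = 0 := t.d_d hκ he _
  rw [h0, zero_mul, mul_zero, zero_add, add_zero] at h
  change t.letter κ e (.inl α) * t.letter κ e (.inl β) -
    t.letter κ e (.inl β) * t.letter κ e (.inl α) = _ at h
  rw [h]
  exact t.d_antighostMap_mem_span _

-- Moving `d b^β` through a word costs one linear commutator per letter, which never increases the
-- length.
include hκ he in
theorem prod_mul_letter_inl_sub_mem (l : List (t.Pos ⊕ t.Pos)) (β : t.Pos) :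
    (l.map (t.letter κ e)).prod * t.letter κ e (.inl β) -
      t.letter κ e (.inl β) * (l.map (t.letter κ e)).prod ∈
        wordSpan (t.letter κ e) (l.length + 1) := by
  induction l with
  | nil => simp
  | cons a l ih =>
    have h1 : t.letter κ e a * t.letter κ e (.inl β) - t.letter κ e (.inl β) * t.letter κ e a ∈
        Submodule.span ℂ (Set.range (t.letter κ e)) := by
      rcases a with α | α
      · exact t.letter_inl_mul_letter_inl hκ he α β
      · rw [← neg_mem_iff, neg_sub]
        change _ * t.antighost α - t.antighost α * _ ∈ _
        rw [letter_inl_mul_antighost]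
        exact t.antighostMap_mem_span _
    have h2 := add_mem (letter_mul_mem_wordSpan a ih)
      (span_mul_mem_wordSpan h1 (prod_mem_wordSpan (Nat.lt_succ_self l.length)))
    rw [List.length_cons]
    convert h2 using 1
    rw [List.map_cons, List.prod_cons]
    noncomm_ring

/-- The parity supplies the signs for moving `b^β` past other antighosts, which is exact; each
letter `d b^α` costs a linear commutator. -/
theorem parity_prod_mul_antighost_sub_mem (l : List (t.Pos ⊕ t.Pos)) (β : t.Pos) :
    omegaParity δ (l.map (t.letter κ e)).prod * t.antighost β -
      t.antighost β * (l.map (t.letter κ e)).prod ∈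
        wordSpan (t.letter κ e) (l.length + 1) := by
  induction l with
  | nil => simp
  | cons a l ih =>
    have h1 := letter_mul_mem_wordSpan a ih
    rw [List.map_cons, List.prod_cons, map_mul, List.length_cons]
    rcases a with α | α
    · have h3 : t.letter κ e (.inl α) * t.antighost β - t.antighost β * t.letter κ e (.inl α) ∈
          Submodule.span ℂ (Set.range (t.letter κ e)) := by
        rw [letter_inl_mul_antighost]
        exact t.antighostMap_mem_span _
      have h2 := add_mem h1
        (span_mul_mem_wordSpan h3 (prod_mem_wordSpan (Nat.lt_succ_self l.length)))
      convert h2 using 1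
      rw [omegaParity_letter_inl]
      noncomm_ring
    · rw [← neg_mem_iff] at h1
      convert h1 using 1
      change omegaParity δ (t.antighost α) * _ * _ - t.antighost β * (t.antighost α * _) =
        -(t.antighost α * _)
      rw [omegaParity_antighost, ← mul_assoc (t.antighost β), t.antighost_mul_antighost β]
      noncomm_ring

theorem parity_mem_wordSpan {k : ℕ} {w : Omega δ} (hw : w ∈ wordSpan (t.letter κ e) k) :
    omegaParity δ w ∈ wordSpan (t.letter κ e) k := by
  induction hw using Submodule.span_induction with
  | mem w hw =>
    obtain ⟨l, hl, rfl⟩ := hw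
    refine wordSpan_mono (Nat.succ_le_of_lt hl) ?_
    clear hl
    induction l with
    | nil => simpa using prod_mem_wordSpan (f := t.letter κ e) (l := []) (by simp)
    | cons a l ih =>
      rw [List.map_cons, List.prod_cons, map_mul]
      rcases a with α | α
      · rw [omegaParity_letter_inl]
        exact letter_mul_mem_wordSpan _ ih
      · change omegaParity δ (t.antighost α) * _ ∈ _
        rw [omegaParity_antighost, neg_mul, neg_mem_iff]
        exact letter_mul_mem_wordSpan (.inr α) ih
  | zero => simp
  | add x y _ _ hx hy => rw [map_add]; exact add_mem hx hy
  | smul r x _ hx => rw [map_smul]; exact Submodule.smul_mem _ _ hx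

theorem mul_antighost_mem_wordSpan {k : ℕ} {w : Omega δ} (hw : w ∈ wordSpan (t.letter κ e) k)
    (β : t.Pos) : w * t.antighost β ∈ wordSpan (t.letter κ e) (k + 1) := by
  induction hw using Submodule.span_induction with
  | mem w hw =>
    obtain ⟨l, hl, rfl⟩ := hw
    refine Submodule.subset_span ⟨l ++ [.inr β], by simpa using hl, by simp [letter]⟩
  | zero => simp
  | add x y _ _ hx hy => rw [add_mul]; exact add_mem hx hy
  | smul r x _ hx => rw [smul_mul_assoc]; exact Submodule.smul_mem _ _ hx

-- By the Leibniz rule d turns single letters `b^α` into `d b^α` and kills the letters `d b^α`, so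
-- lengths are preserved.
include hκ he in
theorem d_mem_wordSpan {k : ℕ} {w : Omega δ} (hw : w ∈ wordSpan (t.letter κ e) k) :
    t.d κ e w ∈ wordSpan (t.letter κ e) k := by
  induction hw using Submodule.span_induction with
  | mem w hw =>
    obtain ⟨l, hl, rfl⟩ := hw
    refine wordSpan_mono (Nat.succ_le_of_lt hl) ?_
    clear hl
    induction l with
    | nil =>
      have h := (t.brst κ e).d_algebraMap 1
      rw [map_one] at h
      simp [h]
    | cons a l ih =>
      rw [List.map_cons, List.prod_cons, d_mul]
      rcases a with α | α
      · have h0 : t.d κ e (t.letter κ e (.inl α)) = 0 := t.d_d hκ he _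
        rw [h0, omegaParity_letter_inl, zero_mul, zero_add]
        exact letter_mul_mem_wordSpan _ ih
      · change t.letter κ e (.inl α) * _ + omegaParity δ (t.antighost α) * _ ∈ _
        rw [omegaParity_antighost, neg_mul, ← sub_eq_add_neg]
        exact sub_mem (letter_mul_mem_wordSpan _ (prod_mem_wordSpan (Nat.lt_succ_self _)))
          (letter_mul_mem_wordSpan (f := t.letter κ e) (.inr α) ih)
  | zero => simp
  | add x y _ _ hx hy => rw [map_add]; exact add_mem hx hy
  | smul r x _ hx => rw [map_smul]; exact Submodule.smul_mem _ _ hx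

omit [Fintype I] [DecidableEq I] in
theorem omegaDiffOp_antighost_mul (ψ : Module.Dual ℂ (UniversalEnvelopingAlgebra ℂ L))
    (β : t.Pos) (w : Omega δ) :
    omegaDiffOp δ ψ (t.antighost β * w) = t.antighost β * omegaDiffOp δ ψ w :=
  map_tmul_one_mul δ _ _ w

/-- The operator acts only on the enveloping algebra, so the ghost part of Ĵ^β and the constant χ
pass through; the extra term comes from J^β. -/
theorem omegaDiffOp_letter_inl_mul (ψ : Module.Dual ℂ (UniversalEnvelopingAlgebra ℂ L))
    (β : t.Pos) (w : Omega δ) :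
    omegaDiffOp δ ψ (t.letter κ e (.inl β) * w) = t.letter κ e (.inl β) * omegaDiffOp δ ψ w +
      omegaDiffOp δ (ψ ∘ₗ LinearMap.mulLeft ℂ
        (UniversalEnvelopingAlgebra.ι ℂ (t.upper κ β))) w := by
  have h1 : ∀ x ν, omegaDiffOp δ ψ (antighostMap δ κ x * t.ghost ν * w) =
      antighostMap δ κ x * t.ghost ν * omegaDiffOp δ ψ w := fun x ν => by
    rw [antighostMap_apply, ghost, Algebra.TensorProduct.tmul_mul_tmul, one_mul]
    exact map_tmul_one_mul δ _ _ w
  simp only [letter, Sum.elim_inl, d_antighost, hatCurrent_eq, hatMap_apply, sub_mul, add_mul,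
    map_sub, map_add, Finset.sum_mul, map_sum, h1, omegaDiffOp_currentMap_mul, ← Algebra.smul_def,
    map_smul]
  abel

end HomogeneousBasis

end Contraction

/-! ### The homotopy on words of letters, and Ω as the product of `Ω_red` with these words. -/

section Homotopy

variable {L : Type*} [LieRing L] [LieAlgebra ℂ L]

namespace HomogeneousBasis

variable {δ : L} {I : Type*} (t : HomogeneousBasis δ I) [Fintype I] [DecidableEq I]
  {κ : LinearMap.BilinForm ℂ L} (hκ : IsInvariantMetric κ) {e : L} (he : ⁅δ, e⁆ = e)

theorem omegaDiffOp_prod_mem (ψ : Module.Dual ℂ (UniversalEnvelopingAlgebra ℂ L))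
    (l : List (t.Pos ⊕ t.Pos)) : omegaDiffOp δ ψ (l.map (t.letter κ e)).prod ∈
      wordSpan (t.letter κ e) (l.length + 1) := by
  induction l generalizing ψ with
  | nil =>
    rw [List.map_nil, List.prod_nil, omegaDiffOp_one]
    exact Submodule.smul_mem _ _
      (by simpa using prod_mem_wordSpan (f := t.letter κ e) (l := []) (by simp))
  | cons a l ih =>
    rw [List.map_cons, List.prod_cons]
    rcases a with α | α
    · rw [omegaDiffOp_letter_inl_mul]
      exact add_mem (letter_mul_mem_wordSpan _ (ih _)) (wordSpan_mono (Nat.le_succ _) (ih _))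
    · change omegaDiffOp δ ψ (t.antighost α * _) ∈ _
      rw [omegaDiffOp_antighost_mul]
      exact letter_mul_mem_wordSpan (f := t.letter κ e) (.inr α) (ih _)

theorem omegaDiffOp_prod_mem_of_map_one (ψ : Module.Dual ℂ (UniversalEnvelopingAlgebra ℂ L))
    (hψ : ψ 1 = 0) (l : List (t.Pos ⊕ t.Pos)) : omegaDiffOp δ ψ (l.map (t.letter κ e)).prod ∈
      wordSpan (t.letter κ e) l.length := by
  induction l with
  | nil => simp [omegaDiffOp_one, hψ]
  | cons a l ih =>
    rw [List.map_cons, List.prod_cons]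
    rcases a with α | α
    · rw [omegaDiffOp_letter_inl_mul]
      exact add_mem (letter_mul_mem_wordSpan _ ih) (t.omegaDiffOp_prod_mem _ l)
    · change omegaDiffOp δ ψ (t.antighost α * _) ∈ _
      rw [omegaDiffOp_antighost_mul]
      exact letter_mul_mem_wordSpan (f := t.letter κ e) (.inr α) ih

/-- The differential operator lowers the length by at least one and the appended antighost restores
one. -/
theorem contraction_mem_wordSpan (ψ : t.Pos → Module.Dual ℂ (UniversalEnvelopingAlgebra ℂ L))
    (hψ : ∀ α, ψ α 1 = 0) {k : ℕ} {w : Omega δ} (hw : w ∈ wordSpan (t.letter κ e) k) :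
    t.contraction (fun α => omegaDiffOp δ (ψ α)) w ∈ wordSpan (t.letter κ e) k := by
  induction hw using Submodule.span_induction with
  | mem w hw =>
    obtain ⟨l, hl, rfl⟩ := hw
    rw [contraction_apply]
    refine wordSpan_mono (Nat.succ_le_of_lt hl) (sum_mem fun α _ => ?_)
    exact t.mul_antighost_mem_wordSpan
      (t.parity_mem_wordSpan (t.omegaDiffOp_prod_mem_of_map_one _ (hψ α) l)) α
  | zero => simp
  | add x y _ _ hx hy => rw [map_add]; exact add_mem hx hy
  | smul r x _ hx => rw [map_smul]; exact Submodule.smul_mem _ _ hx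

variable (φ : t.Pos → Module.Dual ℂ (UniversalEnvelopingAlgebra ℂ L))

omit [DecidableEq I] in
theorem contraction_antighost_mul (β : t.Pos) (w : Omega δ) :
    t.contraction (fun α => omegaDiffOp δ (φ α)) (t.antighost β * w) =
      -(t.antighost β * t.contraction (fun α => omegaDiffOp δ (φ α)) w) := by
  simp only [contraction_apply, omegaDiffOp_antighost_mul, map_mul, omegaParity_antighost,
    neg_mul, Finset.sum_neg_distrib, Finset.mul_sum, mul_assoc]

variable (hφ1 : ∀ α, φ α 1 = 0)
  (hφ : ∀ α β : t.Pos, φ α (UniversalEnvelopingAlgebra.ι ℂ (t.upper κ β)) = if α = β then 1 else 0)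

-- The constant part of φ_α ∘ (t^β ·) is δ_αβ and yields the main term, in which `d b^β` has become
-- `b^β` at the right end. The remainder is a contraction by functionals killing 1, so it does not
-- lengthen words.
include hφ in
theorem exists_contraction_letter_mul (β : t.Pos) :
    ∃ ψ : t.Pos → Module.Dual ℂ (UniversalEnvelopingAlgebra ℂ L), (∀ α, ψ α 1 = 0) ∧
      ∀ w, t.contraction (fun α => omegaDiffOp δ (φ α)) (t.letter κ e (.inl β) * w) =
        t.letter κ e (.inl β) * t.contraction (fun α => omegaDiffOp δ (φ α)) w +
          omegaParity δ w * t.antighost β + t.contraction (fun α => omegaDiffOp δ (ψ α)) w := by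
  set χ := fun α => φ α ∘ₗ LinearMap.mulLeft ℂ (UniversalEnvelopingAlgebra.ι ℂ (t.upper κ β))
    with hχ
  have h1 : ∀ α, χ α 1 = if α = β then 1 else 0 := fun α => by
    rw [hχ, LinearMap.comp_apply, LinearMap.mulLeft_apply, mul_one, hφ]
  refine ⟨fun α => χ α - χ α 1 • counit.toLinearMap, fun α => by simp, fun w => ?_⟩
  have h2 : ∀ α, omegaDiffOp δ (χ α) w = (if α = β then w else 0) +
      omegaDiffOp δ (χ α - χ α 1 • counit.toLinearMap) w := fun α => by
    rw [omegaDiffOp_eq]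
    conv_lhs => enter [1]; rw [h1]
    rw [ite_smul, one_smul, zero_smul]
  simp only [contraction_apply, omegaDiffOp_letter_inl_mul, map_add, map_mul,
    omegaParity_letter_inl, add_mul, Finset.sum_add_distrib, Finset.mul_sum, mul_assoc]
  rw [add_assoc]
  congr 1
  change ∑ α, omegaParity δ (omegaDiffOp δ (χ α) w) * _ = _
  simp only [h2, map_add, add_mul, Finset.sum_add_distrib, apply_ite (omegaParity δ), map_zero,
    ite_mul, zero_mul, Finset.sum_ite_eq', Finset.mem_univ, if_true]

include hκ he hφ1 hφ in
/-- Up to shorter words, `d h + h d` multiplies a word by its length. -/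
theorem d_contraction_add_prod_sub_mem (l : List (t.Pos ⊕ t.Pos)) :
    t.d κ e (t.contraction (fun α => omegaDiffOp δ (φ α)) (l.map (t.letter κ e)).prod) +
      t.contraction (fun α => omegaDiffOp δ (φ α)) (t.d κ e (l.map (t.letter κ e)).prod) -
        (l.length : ℂ) • (l.map (t.letter κ e)).prod ∈ wordSpan (t.letter κ e) l.length := by
  set h := t.contraction (fun α => omegaDiffOp δ (φ α)) with hh
  induction l with
  | nil =>
    have h1 := (t.brst κ e).d_algebraMap 1
    rw [map_one] at h1
    have h2 : h 1 = 0 := by simp [hh, contraction_apply, omegaDiffOp_one, hφ1]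
    simp [h1, h2]
  | cons a l ih =>
    set w := (l.map (t.letter κ e)).prod with hw
    have hwm : w ∈ wordSpan (t.letter κ e) (l.length + 1) := prod_mem_wordSpan (Nat.lt_succ_self _)
    rw [List.map_cons, List.prod_cons, List.length_cons, ← hw]
    rcases a with β | β
    · obtain ⟨ψ, hψ1, hψ⟩ := t.exists_contraction_letter_mul (e := e) φ hφ β
      rw [← hh] at hψ
      have h0 : t.d κ e (t.letter κ e (.inl β)) = 0 := t.d_d hκ he _
      have h1 : t.d κ e (t.antighost β) = t.letter κ e (.inl β) := rfl
      have h2 : t.d κ e (omegaParity δ w) = -omegaParity δ (t.d κ e w) := (t.brst κ e).d_parity w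
      have h3 := letter_mul_mem_wordSpan (f := t.letter κ e) (.inl β) ih
      have h4 := t.prod_mul_letter_inl_sub_mem hκ he l β
      have h5 := t.d_mem_wordSpan hκ he (t.contraction_mem_wordSpan ψ hψ1 hwm)
      have h6 := t.contraction_mem_wordSpan ψ hψ1 (t.d_mem_wordSpan hκ he hwm)
      -- The terms with σ(dw) b^β cancel, and d(σ(w) b^β) leaves w · d b^β. Moving this factor to
      -- the front (`h4`) adds one to the length count of `w`.
      convert add_mem (add_mem h3 h4) (add_mem h5 h6) using 1
      simp only [hψ, d_mul, map_add, h0, h1, h2, omegaParity_letter_inl, omegaParity_omegaParity,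
        ← hw, zero_mul, zero_add, mul_sub, mul_add, mul_smul_comm, Nat.cast_add, Nat.cast_one,
        add_smul, one_smul, neg_mul]
      abel
    · obtain ⟨ψ, hψ1, hψ⟩ := t.exists_contraction_letter_mul (e := e) φ hφ β
      rw [← hh] at hψ
      have hb : ∀ u, h (t.antighost β * u) = -(t.antighost β * h u) :=
        t.contraction_antighost_mul φ β
      have h1 : t.d κ e (t.antighost β) = t.letter κ e (.inl β) := rfl
      have h3 := letter_mul_mem_wordSpan (f := t.letter κ e) (.inr β) ih
      have h4 := t.parity_prod_mul_antighost_sub_mem (κ := κ) (e := e) l β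
      have h5 := t.contraction_mem_wordSpan ψ hψ1 hwm
      -- The terms d b^β · h(w) cancel; the additional copy of the word is σ(w) b^β, reordered by
      -- `h4`.
      convert add_mem (add_mem h3 h4) h5 using 1
      change t.d κ e (h (t.antighost β * w)) + h (t.d κ e (t.antighost β * w)) -
        _ • (t.antighost β * w) = t.antighost β * _ + _ + _
      simp only [hb, d_mul, map_add, map_neg, h1, hψ, omegaParity_antighost, ← hw, mul_sub,
        mul_add, mul_smul_comm, Nat.cast_add, Nat.cast_one, add_smul, one_smul, neg_mul]
      abel

/-- The filtration of `Ω` by the number of contractible generators. -/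
noncomputable def reducedFiltration (κ : LinearMap.BilinForm ℂ L) (e : L) (k : ℕ) :
    Submodule ℂ (Omega δ) :=
  Subalgebra.toSubmodule (t.reduced κ) * wordSpan (t.letter κ e) k

theorem reducedFiltration_mono : Monotone (t.reducedFiltration κ e) := fun _ _ h =>
  mul_le_mul_right (wordSpan_mono h) _

theorem reducedFiltration_one_le :
    t.reducedFiltration κ e 1 ≤ Subalgebra.toSubmodule (t.reduced κ) := by
  refine Submodule.mul_le.2 fun r hr w hw => ?_
  induction hw using Submodule.span_induction with
  | mem w hw =>
    obtain ⟨l, hl, rfl⟩ := hw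
    rw [Nat.lt_one_iff, List.length_eq_zero_iff] at hl
    simpa [hl] using hr
  | zero => simp
  | add x y _ _ hx hy => rw [mul_add]; exact add_mem hx hy
  | smul r x _ hx => rw [mul_smul_comm]; exact Submodule.smul_mem _ _ hx

-- It suffices to move letters rightwards past the generators of `Ω_red`. For antighosts this is the
-- commutation relations; for `d b^β` it follows by applying d, because `Ω_red` is d-stable.
include hκ in
theorem mem_reducedFiltration (x : Omega δ) : ∃ k, x ∈ t.reducedFiltration κ e k := by
  set A := t.reduced κ with hA
  have h1A : (1 : Omega δ) ∈ Subalgebra.toSubmodule A := A.one_mem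
  set B := 1 ⊔ Submodule.span ℂ (Set.range t.antighost) with hB
  set E := B ⊔ Submodule.span ℂ (Set.range (t.letter κ e)) with hE
  have h1B : (1 : Omega δ) ∈ B := Submodule.mem_sup_left (Submodule.one_le.1 le_rfl)
  have hbB : ∀ β, t.antighost β ∈ B := fun β =>
    Submodule.mem_sup_right (Submodule.subset_span ⟨β, rfl⟩)
  have hB' : ∀ x, antighostMap δ κ x ∈ B := fun x => by
    rw [t.antighostMap_eq_sum]
    exact sum_mem fun γ _ => Submodule.smul_mem _ _ (hbB γ)
  have hAB : ∀ b ∈ B, ∀ r ∈ A, b * r ∈ Subalgebra.toSubmodule A * B := by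
    refine mul_mem_of_exchange fun b hb r hr => ?_
    have hrA : r ∈ Subalgebra.toSubmodule A := Algebra.subset_adjoin hr
    rw [hB, Submodule.mem_sup] at hb
    obtain ⟨c, hc, b, hb, rfl⟩ := hb
    rw [add_mul]
    refine add_mem ?_ ?_
    · obtain ⟨c, rfl⟩ := Submodule.mem_one.1 hc
      rw [Algebra.commutes]
      exact Submodule.mul_mem_mul hrA (Submodule.mem_sup_left hc)
    · induction hb using Submodule.span_induction with
      | mem b hb =>
        obtain ⟨β, rfl⟩ := hb
        rcases hr with ⟨a, rfl⟩ | ⟨α, rfl⟩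
        · have h := t.hatCurrent_mul_antighost (κ := κ) a β
          rw [← sub_sub_cancel (t.hatCurrent κ a * t.antighost β) (t.antighost β * _), h]
          refine sub_mem (Submodule.mul_mem_mul hrA (hbB β)) ?_
          have := Submodule.mul_mem_mul h1A (hB' ⁅t.upper κ a, t.upper κ β⁆)
          rwa [one_mul] at this
        · rw [t.antighost_mul_ghost]
          refine sub_mem ?_ (Submodule.mul_mem_mul hrA (hbB β))
          split_ifs
          · have := Submodule.mul_mem_mul h1A h1B
            rwa [one_mul] at this
          · exact zero_mem _
      | zero => simp
      | add x y _ _ hx hy => rw [add_mul]; exact add_mem hx hy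
      | smul r x _ hx => rw [smul_mul_assoc]; exact Submodule.smul_mem _ _ hx
  have hBE : B ≤ E := le_sup_left
  have hdB : ∀ b ∈ B, t.d κ e b ∈ E := fun b hb => by
    rw [hB, Submodule.mem_sup] at hb
    obtain ⟨c, hc, b, hb, rfl⟩ := hb
    obtain ⟨c, rfl⟩ := Submodule.mem_one.1 hc
    rw [map_add, (t.brst κ e).d_algebraMap, zero_add]
    refine Submodule.mem_sup_right ?_
    have h := Submodule.mem_map_of_mem (f := t.d κ e) hb
    rw [Submodule.map_span] at h
    refine Submodule.span_mono ?_ h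
    rintro _ ⟨_, ⟨β, rfl⟩, rfl⟩
    exact ⟨.inl β, rfl⟩
  have hdAB : ∀ x ∈ Subalgebra.toSubmodule A * B, t.d κ e x ∈ Subalgebra.toSubmodule A * E :=
    fun x hx => by
      induction hx using Submodule.mul_induction_on' with
      | mem_mul_mem a ha b hb =>
        rw [d_mul]
        exact add_mem (Submodule.mul_mem_mul (t.d_mem_reduced hκ e a ha) (hBE hb))
          (Submodule.mul_mem_mul (t.omegaParity_mem_reduced κ a ha) (hdB b hb))
      | add x _ y _ hx hy => rw [map_add]; exact add_mem hx hy
  have hAE : Subalgebra.toSubmodule A * B ≤ Subalgebra.toSubmodule A * E :=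
    mul_le_mul_right hBE _
  have hletter : ∀ y ∈ Set.range (t.letter κ e), ∀ r ∈ A,
      y * r ∈ Subalgebra.toSubmodule A * E := by
    rintro _ ⟨β | β, rfl⟩ r hr
    -- Here d b^β · r = d(b^β r) + b^β dr, so no commutators of Ĵ^β with the generators of `Ω_red`
    -- are needed.
    · have h := t.d_mul (κ := κ) e (t.antighost β) r
      rw [omegaParity_antighost, neg_mul, ← sub_eq_add_neg, eq_sub_iff_add_eq] at h
      change t.d κ e (t.antighost β) * r ∈ _
      rw [← h]
      exact add_mem (hdAB _ (hAB _ (hbB β) r hr))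
        (hAE (hAB _ (hbB β) _ (t.d_mem_reduced hκ e r hr)))
    · exact hAE (hAB _ (hbB β) r hr)
  have hEN : E ≤ Subalgebra.toSubmodule (Algebra.adjoin ℂ (Set.range (t.letter κ e))) := by
    refine sup_le (sup_le (Submodule.one_le.2 (Subalgebra.one_mem _)) (Submodule.span_le.2 ?_))
      (Submodule.span_le.2 Algebra.subset_adjoin)
    rintro _ ⟨β, rfl⟩
    exact Algebra.subset_adjoin ⟨.inr β, rfl⟩
  have htop : Algebra.adjoin ℂ ((Set.range (fun a : t.NonPos => t.hatCurrent κ a) ∪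
      Set.range t.ghost) ∪ Set.range (t.letter κ e)) = ⊤ := by
    refine eq_top_iff.2 ?_
    rw [← t.adjoin_hatCurrent_eq_top hκ]
    set S := Algebra.adjoin ℂ ((Set.range (fun a : t.NonPos => t.hatCurrent κ a) ∪
      Set.range t.ghost) ∪ Set.range (t.letter κ e))
    have hl : ∀ s, t.letter κ e s ∈ S := fun s => Algebra.subset_adjoin (Or.inr ⟨s, rfl⟩)
    refine Algebra.adjoin_le ?_
    rintro _ ((⟨a, rfl⟩ | h) | ⟨β, rfl⟩)
    · by_cases ha : 0 < t.deg a
      · have h := hl (.inl ⟨a, ha⟩)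
        rw [letter, Sum.elim_inl, d_antighost] at h
        simpa using add_mem h (S.algebraMap_mem (t.chi e ⟨a, ha⟩))
      · exact Algebra.subset_adjoin (Or.inl (Or.inl ⟨⟨a, not_lt.1 ha⟩, rfl⟩))
    · exact Algebra.subset_adjoin (Or.inl (Or.inr h))
    · exact hl (.inr β)
  have hx : x ∈ (⊤ : Submodule ℂ (Omega δ)) := Submodule.mem_top
  rw [← adjoin_mul_adjoin_eq_top htop hEN hletter] at hx
  induction hx using Submodule.mul_induction_on' with
  | mem_mul_mem a ha n hn =>
    obtain ⟨k, hk⟩ := mem_wordSpan_of_mem_adjoin hn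
    exact ⟨k, Submodule.mul_mem_mul ha hk⟩
  | add x _ y _ hx hy =>
    obtain ⟨j, hj⟩ := hx
    obtain ⟨k, hk⟩ := hy
    exact ⟨max j k, add_mem (t.reducedFiltration_mono (le_max_left _ _) hj)
      (t.reducedFiltration_mono (le_max_right _ _) hk)⟩

end HomogeneousBasis

end Homotopy

/-! ### The homotopy on Ω and the comparison of cohomologies. -/

section Acyclic

variable {L : Type*} [LieRing L] [LieAlgebra ℂ L]

namespace HomogeneousBasis

variable {δ : L} {I : Type*} (t : HomogeneousBasis δ I) [Fintype I] [DecidableEq I]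
  {κ : LinearMap.BilinForm ℂ L} (hκ : IsInvariantMetric κ) {e : L} (he : ⁅δ, e⁆ = e)

/-- The subalgebra of the enveloping algebra generated by the `t^a` with `a` satisfying `p`. -/
noncomputable def currentSubalgebra (κ : LinearMap.BilinForm ℂ L) (p : I → Prop) :
    Subalgebra ℂ (UniversalEnvelopingAlgebra ℂ L) :=
  Algebra.adjoin ℂ (Set.range fun a : {a // p a} => UniversalEnvelopingAlgebra.ι ℂ (t.upper κ a))

theorem hatCurrent_mul_mem_tensorSpan {p : I → Prop} {a : I} (ha : p a) {w : Omega δ}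
    (hw : w ∈ tensorSpan δ (t.currentSubalgebra κ p)) :
    t.hatCurrent κ a * w ∈ tensorSpan δ (t.currentSubalgebra κ p) := by
  rw [hatCurrent_eq, hatMap_apply, add_mul, Finset.sum_mul]
  have hι : UniversalEnvelopingAlgebra.ι ℂ (t.upper κ a) ∈ t.currentSubalgebra κ p :=
    Algebra.subset_adjoin ⟨⟨a, ha⟩, rfl⟩
  refine add_mem (tmul_mul_mem_tensorSpan hι _ hw) (sum_mem fun β _ => ?_)
  rw [antighostMap_apply, ghost, Algebra.TensorProduct.tmul_mul_tmul, one_mul]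
  exact tmul_mul_mem_tensorSpan (Subalgebra.one_mem _) _ hw

/-- Together with `wordSpan_le_tensorSpan`, this places the factors r and w of a product in the two
complementary parts of the enveloping algebra, tensored with the full Clifford algebra. -/
theorem reduced_le_tensorSpan : Subalgebra.toSubmodule (t.reduced κ) ≤
    tensorSpan δ (t.currentSubalgebra κ fun a => t.deg a ≤ 0) := by
  refine adjoin_le_of_mul_mem (one_mem_tensorSpan _ _) ?_
  rintro _ (⟨a, rfl⟩ | ⟨α, rfl⟩) w hw
  · exact t.hatCurrent_mul_mem_tensorSpan (p := fun a => t.deg a ≤ 0) a.2 hw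
  · exact tmul_mul_mem_tensorSpan (Subalgebra.one_mem _) _ hw

theorem wordSpan_le_tensorSpan (k : ℕ) : wordSpan (t.letter κ e) k ≤
    tensorSpan δ (t.currentSubalgebra κ fun a => 0 < t.deg a) := by
  refine Submodule.span_le.2 ?_
  rintro _ ⟨l, -, rfl⟩
  induction l with
  | nil => exact one_mem_tensorSpan _ _
  | cons a l ih =>
    rw [List.map_cons, List.prod_cons, SetLike.mem_coe]
    rcases a with α | α
    · rw [letter, Sum.elim_inl, d_antighost, sub_mul, ← Algebra.smul_def]
      exact sub_mem (t.hatCurrent_mul_mem_tensorSpan (p := fun a => 0 < t.deg a) α.2 ih)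
        (Submodule.smul_mem _ _ ih)
    · exact tmul_mul_mem_tensorSpan (Subalgebra.one_mem _) _ ih

include hκ in
theorem lie_upper_mem_span (p : I → Prop)
    (hp : ∀ a b c, p a → p b → t.deg c = t.deg a + t.deg b → p c) (a b : {a // p a}) :
    ⁅t.upper κ a, t.upper κ b⁆ ∈
      Submodule.span ℂ (Set.range fun a : {a // p a} => t.upper κ a) := by
  rw [t.lie_upper hκ]
  refine sum_mem fun c _ => ?_
  by_cases h : t.str κ a b c = 0
  · rw [h, zero_smul]
    exact zero_mem _
  · exact Submodule.smul_mem _ _ (Submodule.subset_span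
      ⟨⟨c, hp a b c a.2 b.2 (t.deg_eq_of_str_ne_zero hκ h)⟩, rfl⟩)

variable (φ : I → Module.Dual ℂ (UniversalEnvelopingAlgebra ℂ L)) (hφ1 : ∀ a, φ a 1 = 0)
  (hφ : ∀ a b, φ a (UniversalEnvelopingAlgebra.ι ℂ (t.upper κ b)) = if a = b then 1 else 0)

include hκ he hφ1 hφ

/-- The operators D_α are not linear over the enveloping algebra of g₀ ⊕ g₊. They are therefore
replaced by the left linear operators `E α` that agree with them on the g₋ part, which is where
words of letters live. -/
theorem exists_homotopy : ∃ h : Module.End ℂ (Omega δ),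
    (∀ k, ∀ x ∈ omegaDegree δ k, h x ∈ omegaDegree δ (k - 1)) ∧ (∀ r ∈ t.reduced κ, h r = 0) ∧
    ∀ k, ∀ x ∈ t.reducedFiltration κ e (k + 1),
      t.d κ e (h x) + h (t.d κ e x) - (k : ℂ) • x ∈ t.reducedFiltration κ e k := by
  have hE := exists_linear_extension (t.upper κ)
    (fun a b => by
      rw [t.lie_upper hκ]
      exact sum_mem fun c _ => Submodule.smul_mem _ _ (Submodule.subset_span ⟨c, rfl⟩))
    φ hφ1 hφ (fun a => t.deg a ≤ 0) (fun a => 0 < t.deg a) (fun a h => h.1.not_gt h.2)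
    (t.lie_upper_mem_span hκ _ fun a b c ha hb hc => by omega)
    (t.lie_upper_mem_span hκ _ fun a b c ha hb hc => by omega)
  choose E hE using fun α : t.Pos => hE (diffOp (φ α))
  set F : t.Pos → Module.End ℂ (Omega δ) := fun α => TensorProduct.map (E α) LinearMap.id
  set h₀ := t.contraction (fun α => omegaDiffOp δ (φ α)) with hh₀
  have hh : ∀ r ∈ t.reduced κ, ∀ k, ∀ w ∈ wordSpan (t.letter κ e) k,
      t.contraction F (r * w) = omegaParity δ r * h₀ w := fun r hr k w hw => by
    have h1 : ∀ α, F α (r * w) = r * omegaDiffOp δ (φ α) w := fun α =>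
      map_mul_of_mem_tensorSpan (hE α) (t.reduced_le_tensorSpan hr)
        (t.wordSpan_le_tensorSpan k hw)
    simp only [hh₀, contraction_apply, h1, map_mul, Finset.mul_sum, mul_assoc]
  refine ⟨t.contraction F, fun k x hx => t.contraction_mem_omegaDegree
    (fun α x hx => map_mem_omegaDegree _ hx) hx, fun r hr => ?_, fun k x hx => ?_⟩
  · have h1 : (1 : Omega δ) ∈ wordSpan (t.letter κ e) 1 := by
      simpa using prod_mem_wordSpan (f := t.letter κ e) (l := []) (by simp)
    have h2 := hh r hr 1 1 h1
    rw [mul_one] at h2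
    rw [h2]
    simp [hh₀, contraction_apply, omegaDiffOp_one, hφ1]
  · induction hx using Submodule.mul_induction_on' with
    | mem_mul_mem r hr w hw =>
      have hdr := t.d_mem_reduced hκ e r hr
      have hsr := t.omegaParity_mem_reduced κ r hr
      have hdw := t.d_mem_wordSpan hκ he hw
      have h1 : t.d κ e (omegaParity δ r) = -omegaParity δ (t.d κ e r) := (t.brst κ e).d_parity r
      -- Both h and d are odd, so the two terms containing dr cancel and d h + h d is left
      -- `Ω_red`-linear.
      have h2 : t.d κ e (t.contraction F (r * w)) + t.contraction F (t.d κ e (r * w)) -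
          (k : ℂ) • (r * w) = r * (t.d κ e (h₀ w) + h₀ (t.d κ e w) - (k : ℂ) • w) := by
        rw [hh r hr _ w hw, d_mul, d_mul, map_add, hh _ hdr _ w hw, hh _ hsr _ _ hdw, h1,
          omegaParity_omegaParity, mul_sub, mul_add, mul_smul_comm, neg_mul]
        abel
      rw [h2]
      refine Submodule.mul_mem_mul hr ?_
      clear h2 hdw
      induction hw using Submodule.span_induction with
      | mem w hw =>
        obtain ⟨l, hl, rfl⟩ := hw
        have h3 := t.d_contraction_add_prod_sub_mem hκ he (fun α => φ α) (fun α => hφ1 α)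
          (fun α β => by rw [hφ]; simp only [Subtype.ext_iff]) l
        -- Only words of length exactly k have leading eigenvalue k; for shorter words every term
        -- already lies in the lower step.
        rcases (Nat.lt_succ_iff.1 hl).lt_or_eq with hlt | rfl
        · have h4 := prod_mem_wordSpan (f := t.letter κ e) hlt
          have h5 := add_mem (wordSpan_mono hlt.le h3) (Submodule.smul_mem _ (l.length : ℂ) h4)
          rw [sub_add_cancel] at h5
          exact sub_mem h5 (Submodule.smul_mem _ _ h4)
        · exact h3
      | zero => simp
      | add x y _ _ hx hy =>
        convert add_mem hx hy using 1
        simp only [map_add, smul_add]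
        abel
      | smul c x _ hx =>
        convert Submodule.smul_mem _ c hx using 1
        simp only [map_smul, smul_sub, smul_add, smul_comm c]
    | add x _ y _ hx hy =>
      convert add_mem hx hy using 1
      simp only [map_add, smul_add]
      abel

/-- The complex `Ω / Ω_red` is acyclic: in graded pieces `M`, every cochain with coboundary in
`Ω_red` is a sum of a coboundary and an element of `Ω_red`. -/
theorem exists_sub_d_mem_reduced (M : Submodule ℂ (Omega δ)) (M' : Submodule ℂ (Omega δ))
    (hM : M = ⊤ ∧ M' = ⊤ ∨ ∃ k, M = omegaDegree δ k ∧ M' = omegaDegree δ (k - 1))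
    {x : Omega δ} (hx : x ∈ M) (hdx : t.d κ e x ∈ t.reduced κ) :
    ∃ y ∈ M', x - t.d κ e y ∈ t.reduced κ := by
  obtain ⟨h, hdeg, hred, hfil⟩ := t.exists_homotopy hκ he φ hφ1 hφ
  have hMh : ∀ x ∈ M, h x ∈ M' := by
    rcases hM with ⟨rfl, rfl⟩ | ⟨k, rfl, rfl⟩
    · exact fun _ _ => Submodule.mem_top
    · exact hdeg k
  have hMd : ∀ y ∈ M', t.d κ e y ∈ M := by
    rcases hM with ⟨rfl, rfl⟩ | ⟨k, rfl, rfl⟩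
    · exact fun _ _ => Submodule.mem_top
    · intro y hy
      simpa using t.d_mem_omegaDegree e hy
  obtain ⟨k, hk⟩ := t.mem_reducedFiltration hκ x
  -- After this shift k bounds the word length, and the case k = 0 allows only the empty word, that
  -- is, `Ω_red`.
  replace hk := t.reducedFiltration_mono (Nat.le_succ k) hk
  induction k generalizing x with
  | zero => exact ⟨0, zero_mem _, by simpa using t.reducedFiltration_one_le hk⟩
  | succ k ih =>
    have h1 := hfil _ x hk
    rw [hred _ hdx, add_zero] at h1
    have hc : ((k + 1 : ℕ) : ℂ) ≠ 0 := Nat.cast_ne_zero.2 k.succ_ne_zero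
    -- As dx lies in `Ω_red`, h(dx) = 0; so d(h x) equals (k + 1) x modulo shorter words, and
    -- subtracting dy removes the top part of x.
    set y := ((k + 1 : ℕ) : ℂ)⁻¹ • h x with hy
    have hyM : y ∈ M' := Submodule.smul_mem _ _ (hMh x hx)
    have h2 : x - t.d κ e y ∈ t.reducedFiltration κ e (k + 1) := by
      convert Submodule.smul_mem _ (-((k + 1 : ℕ) : ℂ)⁻¹) h1 using 1
      rw [hy, map_smul, smul_sub, smul_smul, neg_mul, inv_mul_cancel₀ hc]
      module
    obtain ⟨z, hz, hz'⟩ := ih (x := x - t.d κ e y) (sub_mem hx (hMd y hyM))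
      (by rwa [map_sub, t.d_d hκ he, sub_zero]) h2
    exact ⟨y + z, add_mem hyM hz, by rwa [map_add, ← sub_sub]⟩

/-- If z in `Ω_red` equals dw, correcting w by a coboundary brings it into `Ω_red`: injectivity.
Correcting a cocycle of Ω in the same way gives surjectivity. -/
theorem bijective_reducedDegCohomologyMap (k : ℤ) :
    Function.Bijective (t.reducedDegCohomologyMap κ e k) := by
  have hac := fun k (x : Omega δ) => t.exists_sub_d_mem_reduced hκ he φ hφ1 hφ (omegaDegree δ k)
    (omegaDegree δ (k - 1)) (.inr ⟨k, rfl, rfl⟩) (x := x)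
  constructor
  · rw [injective_iff_map_eq_zero]
    intro x hx
    obtain ⟨⟨z, ⟨hzA, hzk⟩, hz⟩, rfl⟩ := Submodule.Quotient.mk_surjective _ x
    obtain ⟨w, ⟨-, hwk⟩, hw⟩ := (Submodule.Quotient.mk_eq_zero _).1 hx
    have hw' : t.d κ e w = z := hw
    obtain ⟨v, hv, hwv⟩ := hac (k - 1) w hwk (by rw [hw']; exact hzA)
    refine (Submodule.Quotient.mk_eq_zero _).2 ⟨w - t.d κ e v, ⟨hwv, sub_mem hwk ?_⟩, ?_⟩
    · simpa using t.d_mem_omegaDegree (κ := κ) e hv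
    · change t.d κ e (w - t.d κ e v) = z
      rw [map_sub, t.d_d hκ he, sub_zero, hw']
  · intro x
    obtain ⟨⟨z, ⟨-, hzk⟩, hz⟩, rfl⟩ := Submodule.Quotient.mk_surjective _ x
    have hz' : t.d κ e z = 0 := hz
    obtain ⟨v, hv, hzv⟩ := hac k z hzk (by rw [hz']; exact zero_mem _)
    have hdv : t.d κ e v ∈ omegaDegree δ k := by simpa using t.d_mem_omegaDegree (κ := κ) e hv
    refine ⟨Submodule.Quotient.mk ⟨z - t.d κ e v, ⟨hzv, sub_mem hzk hdv⟩, ?_⟩, ?_⟩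
    · change t.d κ e (z - t.d κ e v) = 0
      rw [map_sub, t.d_d hκ he, sub_zero, hz']
    · refine (Submodule.Quotient.eq _).2 ⟨-v, ⟨trivial, neg_mem hv⟩, ?_⟩
      change t.d κ e (-v) = z - t.d κ e v - z
      rw [map_neg]
      abel

theorem bijective_reducedCohomologyMap : Function.Bijective (t.reducedCohomologyMap κ e) := by
  have hac := fun x : Omega δ => t.exists_sub_d_mem_reduced hκ he φ hφ1 hφ ⊤ ⊤ (.inl ⟨rfl, rfl⟩)
    (x := x) trivial
  constructor
  · rw [injective_iff_map_eq_zero]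
    intro x hx
    obtain ⟨⟨z, hzA, hz⟩, rfl⟩ := Ideal.Quotient.mk_surjective x
    obtain ⟨w, -, hw⟩ := Ideal.Quotient.eq_zero_iff_mem.1 hx
    have hw' : t.d κ e w = z := hw
    obtain ⟨v, -, hwv⟩ := hac w (by rw [hw']; exact hzA)
    refine Ideal.Quotient.eq_zero_iff_mem.2 ⟨w - t.d κ e v, hwv, ?_⟩
    change t.d κ e (w - t.d κ e v) = z
    rw [map_sub, t.d_d hκ he, sub_zero, hw']
  · intro x
    obtain ⟨⟨z, -, hz⟩, rfl⟩ := Ideal.Quotient.mk_surjective x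
    have hz' : t.d κ e z = 0 := hz
    obtain ⟨v, -, hzv⟩ := hac z (by rw [hz']; exact zero_mem _)
    refine ⟨Ideal.Quotient.mk _ ⟨z - t.d κ e v, hzv, ?_⟩, ?_⟩
    · change t.d κ e (z - t.d κ e v) = 0
      rw [map_sub, t.d_d hκ he, sub_zero, hz']
    · refine (Ideal.Quotient.mk_eq_mk_iff_sub_mem _ _).2 ⟨-v, trivial, ?_⟩
      change t.d κ e (-v) = z - t.d κ e v - z
      rw [map_neg]
      abel

end HomogeneousBasis

end Acyclic

/-! ### The trace form of sl_n and the dual functionals on its enveloping algebra. -/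

section SpecialLinearMetric

variable (μ : YoungDiagram)

/-- Each matrix unit in `t₊` joins column k to column k + 1, where the entries of δ differ by
exactly one. -/
theorem lie_delta_tPlus : ⁅delta μ, tPlus μ⁆ = tPlus μ := by
  refine Subtype.ext ?_
  change (delta μ).1 * (tPlus μ).1 - (tPlus μ).1 * (delta μ).1 = (tPlus μ).1
  ext p q
  rw [Matrix.sub_apply]
  simp only [delta, tPlus, Matrix.diagonal_mul, Matrix.mul_diagonal, Matrix.of_apply]
  split_ifs with h
  · rw [← h.2]
    push_cast
    ring
  · ring

theorem trForm_apply (x y : SL μ) : trForm μ x y = Matrix.trace (x.1 * y.1) := rfl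

theorem trForm_comm (x y : SL μ) : trForm μ x y = trForm μ y x := by
  rw [trForm_apply, trForm_apply, Matrix.trace_mul_comm]

theorem trForm_invariant (x y z : SL μ) : trForm μ ⁅x, y⁆ z = trForm μ x ⁅y, z⁆ := by
  change Matrix.trace ((x.1 * y.1 - y.1 * x.1) * z.1) = Matrix.trace (x.1 * (y.1 * z.1 - z.1 * y.1))
  rw [sub_mul, mul_sub, Matrix.trace_sub, Matrix.trace_sub, mul_assoc, mul_assoc,
    Matrix.trace_mul_comm y.1, mul_assoc]

/-- Pairing with off-diagonal matrix units and with E_pp - E_qq forces x to be a scalar matrix, and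
tracelessness makes it zero. -/
theorem trForm_nondegenerate : (trForm μ).Nondegenerate := by
  have h : (trForm μ).SeparatingLeft := fun x hx => by
    have hoff : ∀ p q, p ≠ q → x.1 p q = 0 := fun p q hpq => by
      have h := hx ⟨Matrix.single q p 1, by
        change Matrix.trace _ = 0
        exact Matrix.trace_single_eq_of_ne _ _ _ hpq.symm⟩
      rw [trForm_apply, Matrix.trace_mul_single] at h
      simpa using h
    have hdiag : ∀ p q, x.1 p p = x.1 q q := fun p q => by
      have h := hx ⟨Matrix.single p p 1 - Matrix.single q q 1, by
        change Matrix.trace _ = 0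
        simp⟩
      rw [trForm_apply, mul_sub, Matrix.trace_sub, Matrix.trace_mul_single,
        Matrix.trace_mul_single] at h
      simpa [sub_eq_zero] using h
    have htr : Matrix.trace x.1 = 0 := x.2
    refine Subtype.ext (Matrix.ext fun p q => ?_)
    by_cases hpq : p = q
    · subst hpq
      have h1 : Matrix.trace x.1 = Fintype.card (Box μ) * x.1 p p := by
        have h2 : Matrix.trace x.1 = ∑ _ : Box μ, x.1 p p :=
          Finset.sum_congr rfl fun q _ => hdiag q p
        rw [h2, Finset.sum_const, Finset.card_univ, nsmul_eq_mul]
      have : Nonempty (Box μ) := ⟨p⟩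
      rw [htr, zero_eq_mul] at h1
      exact h1.resolve_left (Nat.cast_ne_zero.2 Fintype.card_ne_zero)
    · exact hoff p q hpq
  exact ⟨h, fun x hx => h x fun y => by rw [trForm_comm]; exact hx y⟩

theorem isInvariantMetric_smul_trForm {r : ℂ} (hr : r ≠ 0) :
    IsInvariantMetric (r • trForm μ) where
  nondegenerate :=
    ⟨fun x hx => (trForm_nondegenerate μ).1 x fun y => by simpa [hr] using hx y,
      fun x hx => (trForm_nondegenerate μ).2 x fun y => by simpa [hr] using hx y⟩
  invariant x y z := by
    simp only [LinearMap.smul_apply, trForm_invariant]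

/-- The defining representation of the enveloping algebra of `sl_n`. -/
noncomputable def definingRep :
    UniversalEnvelopingAlgebra ℂ (SL μ) →ₐ[ℂ] Matrix (Box μ) (Box μ) ℂ :=
  envelopingLift
    { toFun := fun x => x.1
      map_add' := fun _ _ => rfl
      map_smul' := fun _ _ => rfl }
    fun _ _ => rfl

theorem definingRep_ι (x : SL μ) : definingRep μ (UniversalEnvelopingAlgebra.ι ℂ x) = x.1 :=
  envelopingLift_ι _ _ x

/-- The functional `u ↦ r Tr (ρ(u) x)`. -/
noncomputable def traceFunctional (r : ℂ) (x : SL μ) :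
    Module.Dual ℂ (UniversalEnvelopingAlgebra ℂ (SL μ)) :=
  r • (Matrix.traceLinearMap (Box μ) ℂ ℂ ∘ₗ LinearMap.mulRight ℂ x.1 ∘ₗ
    (definingRep μ).toLinearMap)

theorem traceFunctional_one (r : ℂ) (x : SL μ) : traceFunctional μ r x 1 = 0 := by
  have hx : Matrix.trace x.1 = 0 := x.2
  simp [traceFunctional, hx]

/-- On the Lie algebra the functional is the metric, so for x = t_a it is dual to the vectors t^b,
as the homotopy requires. -/
theorem traceFunctional_ι (r : ℂ) (x y : SL μ) :
    traceFunctional μ r x (UniversalEnvelopingAlgebra.ι ℂ y) = (r • trForm μ) y x := by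
  rw [traceFunctional, LinearMap.smul_apply, LinearMap.comp_apply, LinearMap.comp_apply,
    AlgHom.toLinearMap_apply, definingRep_ι]
  rfl

end SpecialLinearMetric

end FiniteW

/-! ### Assembly for sl_n. -/

theorem mainTheorem8 (μ : YoungDiagram) {I : Type*} [Fintype I] [DecidableEq I]
    (t : FiniteW.HomogeneousBasis (FiniteW.delta μ) I)
    (κ : LinearMap.BilinForm ℂ (FiniteW.SL μ)) (r : ℂ) (hr : r ≠ 0)
    (hκ : κ = r • FiniteW.trForm μ) :
    -- `(Ω; d)` is a graded complex
    DirectSum.IsInternal (FiniteW.omegaDegree (FiniteW.delta μ)) ∧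
    (∀ k, ∀ x ∈ FiniteW.omegaDegree (FiniteW.delta μ) k,
      t.d κ (FiniteW.tPlus μ) x ∈ FiniteW.omegaDegree (FiniteW.delta μ) (k + 1)) ∧
    (∀ x, t.d κ (FiniteW.tPlus μ) (t.d κ (FiniteW.tPlus μ) x) = 0) ∧
    -- `Ω` is generated by `Ĵ^a`, `c_α`, `b^α`, on which `d` is given by the stated formulas
    Algebra.adjoin ℂ (Set.range (t.hatCurrent κ) ∪ Set.range t.ghost ∪ Set.range t.antighost) = ⊤ ∧
    (∀ a : I, t.d κ (FiniteW.tPlus μ) (t.hatCurrent κ a) =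
      ∑ α : t.Pos, ∑ γ : t.NonPos, t.str κ α a γ • (t.hatCurrent κ γ * t.ghost α) -
        ∑ β : t.Pos, ∑ γ : t.Pos, (t.str κ a β γ * t.chi (FiniteW.tPlus μ) γ) • t.ghost β) ∧
    (∀ α : t.Pos, t.d κ (FiniteW.tPlus μ) (t.ghost α) =
      -((1 / 2 : ℂ) • ∑ β : t.Pos, ∑ γ : t.Pos, t.str κ β γ α • (t.ghost β * t.ghost γ))) ∧
    (∀ α : t.Pos, t.d κ (FiniteW.tPlus μ) (t.antighost α) =
      t.hatCurrent κ α - algebraMap ℂ _ (t.chi (FiniteW.tPlus μ) α)) ∧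
    -- `Ω_red` is a subcomplex
    (∀ x ∈ t.reduced κ, t.d κ (FiniteW.tPlus μ) x ∈ t.reduced κ) ∧
    -- the inclusion induces isomorphisms `H ^ k(Ω_red; d) → H ^ k(Ω; d)` for all `k`
    (∀ k : ℤ, Function.Bijective (t.reducedDegCohomologyMap κ (FiniteW.tPlus μ) k)) ∧
    -- and an isomorphism of the cohomology algebras
    Function.Bijective (t.reducedCohomologyMap κ (FiniteW.tPlus μ)) := by
  subst hκ
  have hκ := FiniteW.isInvariantMetric_smul_trForm μ hr
  have he := FiniteW.lie_delta_tPlus μ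
  have hφ1 : ∀ a, FiniteW.traceFunctional μ r (t.basis a) 1 = 0 := fun a =>
    FiniteW.traceFunctional_one μ r _
  have hφ : ∀ a b, FiniteW.traceFunctional μ r (t.basis a)
      (UniversalEnvelopingAlgebra.ι ℂ (t.upper (r • FiniteW.trForm μ) b)) =
        if a = b then 1 else 0 := fun a b => by
    rw [FiniteW.traceFunctional_ι, t.form_upper_basis hκ]
    simp only [eq_comm]
  exact ⟨FiniteW.isInternal_omegaDegree _, fun k x hx => t.d_mem_omegaDegree _ hx,
    t.d_d hκ he, t.adjoin_hatCurrent_eq_top hκ, t.d_hatCurrent hκ _, t.d_ghost _,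
    t.d_antighost _, t.d_mem_reduced hκ _,
    t.bijective_reducedDegCohomologyMap hκ he _ hφ1 hφ,
    t.bijective_reducedCohomologyMap hκ he _ hφ1 hφ⟩
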